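/- Let $(R,\mathfrak m)$ be a Noetherian local ring of dimension $d\ge 2$. Suppose that there is an injective $R$-linear map $R\hookrightarrow E$, where $E$ is a finitely generated maximal Cohen–Macaulay $R$-module, i.e. a nonzero finitely generated $R$-module with $\operatorname{depth} E=\dim E=\dim R$. If $R$ is not Cohen–Macaulay, then $e_1(J)<0$ for every parameter ideal $J$ of $R$. Here a parameter ideal of $R$ is an ideal $J\subseteq\mathfrak m$ that is generated by $d$ elements and satisfies $\lambda(R/J)<\infty$, where $\lambda$ denotes length, and $e_0(J),\dots,e_d(J)\in\mathbb Z$ are the Hilbert coefficients of $J$, i.e. the unique integers such that for all sufficiently large $n$ $$\lambda(R/J^n)=\sum_{i=0}^{d}(-1)^i e_i(J)\binom{n+d-i-1}{d-i}.$$ -/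

import Mathlib

namespace LocalHilbert

open IsLocalRing Filter

/-- The Krull dimension of a module (the dimension of its support) as a natural number.
It is finite for finitely generated modules over Noetherian local rings; the zero module and
modules of infinite dimension get the value `0`. -/
noncomputable def moduleDim (R M : Type*) [CommRing R] [AddCommGroup M] [Module R M] : ℕ :=
  ((Module.supportDim R M).unbotD 0).toNat

/-- The depth of a module over a local ring: the supremum of the lengths of the `M`-regular
sequences in the maximal ideal. It is used for nonzero modules only. -/
noncomputable def depth (R M : Type*) [CommRing R] [IsLocalRing R] [AddCommGroup M]
    [Module R M] : ℕ∞ :=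
  sSup {n : ℕ∞ | ∃ rs : List R, (rs.length : ℕ∞) = n ∧ (∀ r ∈ rs, r ∈ maximalIdeal R) ∧
    RingTheory.Sequence.IsRegular M rs}

/-- A finitely generated module `M` over a (Noetherian) local ring is Cohen–Macaulay if it is
zero or `depth M = dim M`. -/
def IsCohenMacaulayModule (R M : Type*) [CommRing R] [IsLocalRing R] [AddCommGroup M]
    [Module R M] : Prop :=
  Module.Finite R M ∧
    (Subsingleton M ∨ ((depth R M : ℕ∞) : WithBot ℕ∞) = Module.supportDim R M)

/-- A maximal Cohen–Macaulay module: a Cohen–Macaulay module with `dim M = dim R`.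
Such a module is nonzero, since the zero module has dimension `⊥`. -/
def IsMaximalCohenMacaulayModule (R M : Type*) [CommRing R] [IsLocalRing R] [AddCommGroup M]
    [Module R M] : Prop :=
  IsCohenMacaulayModule R M ∧ Module.supportDim R M = ringKrullDim R

/-- A local ring is Cohen–Macaulay if it is Cohen–Macaulay as a module over itself. -/
def IsCohenMacaulayLocalRing (R : Type*) [CommRing R] [IsLocalRing R] : Prop :=
  IsCohenMacaulayModule R R

/-- A parameter ideal for `M`: a proper ideal generated by `d = dim M` elements such that
`M / I M` has finite length. -/
def IsParameterIdeal (R M : Type*) [CommRing R] [IsLocalRing R] [AddCommGroup M] [Module R M]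
    (I : Ideal R) : Prop :=
  I ≤ maximalIdeal R ∧
  (∃ x : Fin (moduleDim R M) → R, I = Ideal.span (Set.range x)) ∧
  Module.length R (M ⧸ (I • ⊤ : Submodule R M)) ≠ ⊤

/-- `e 0, …, e d`, `d = dim M`, are the Hilbert coefficients of `I` with respect to `M`: for all
large `n`, the length of `M / I ^ n M` is finite and equal to
`∑ i ≤ d, (-1) ^ i * e i * C(n + d - i - 1, d - i)`. The sequence is extended by `0` beyond `d`. -/
def IsHilbertCoefficients (R M : Type*) [CommRing R] [AddCommGroup M] [Module R M]
    (I : Ideal R) (e : ℕ → ℤ) : Prop :=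
  (∀ i, moduleDim R M < i → e i = 0) ∧
  ∀ᶠ n : ℕ in atTop,
    Module.length R (M ⧸ (I ^ n • ⊤ : Submodule R M)) ≠ ⊤ ∧
    ((Module.length R (M ⧸ (I ^ n • ⊤ : Submodule R M))).toNat : ℤ) =
      ∑ i ∈ Finset.range (moduleDim R M + 1),
        (-1) ^ i * e i * ((n + (moduleDim R M - i) - 1).choose (moduleDim R M - i) : ℤ)

theorem eq_zero_of_eventually_sum_choose (d : ℕ) : ∀ a : ℕ → ℤ,
    (∀ᶠ n : ℕ in atTop, ∑ k ∈ Finset.range (d + 1), a k * ((n + k - 1).choose k : ℤ) = 0) →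
    ∀ k ≤ d, a k = 0 := by
  induction d with
  | zero =>
    intro a h k hk
    obtain ⟨n, hn⟩ := h.exists
    obtain rfl : k = 0 := by omega
    simpa using hn
  | succ d ih =>
    intro a h
    have key : ∀ j ≤ d, a (j + 1) = 0 := by
      apply ih (fun j => a (j + 1))
      obtain ⟨N, hN⟩ := eventually_atTop.1 h
      refine eventually_atTop.2 ⟨N + 2, fun m hm => ?_⟩
      obtain ⟨n, rfl⟩ : ∃ n, m = n + 1 := ⟨m - 1, by omega⟩
      have h1 := hN (n + 1) (by omega)
      have h0 := hN n (by omega)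
      rw [Finset.sum_range_succ'] at h1 h0
      have hs : ∑ k ∈ Finset.range (d + 1), a (k + 1) * ((n + 1 + k - 1).choose k : ℤ) =
          ∑ k ∈ Finset.range (d + 1), a (k + 1) * ((n + 1 + (k + 1) - 1).choose (k + 1) : ℤ) -
          ∑ k ∈ Finset.range (d + 1), a (k + 1) * ((n + (k + 1) - 1).choose (k + 1) : ℤ) := by
        rw [← Finset.sum_sub_distrib]
        refine Finset.sum_congr rfl fun k _ => ?_
        have e1 : n + 1 + (k + 1) - 1 = (n + k) + 1 := by omega
        have e2 : n + (k + 1) - 1 = n + k := by omega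
        have e3 : n + 1 + k - 1 = n + k := by omega
        rw [e1, e2, e3, Nat.choose_succ_succ]
        push_cast
        ring
      rw [hs]
      simp only [add_zero, Nat.choose_zero_right] at h1 h0
      linarith
    intro k hk
    rcases k with _ | j
    · obtain ⟨n, hn⟩ := h.exists
      rw [Finset.sum_range_succ', Finset.sum_eq_zero] at hn
      · simpa using hn
      · intro k hk
        rw [key k (by simpa [Nat.lt_succ_iff] using hk), zero_mul]
    · exact key j (by omega)

/-- The Hilbert coefficients are uniquely determined. -/
theorem IsHilbertCoefficients.unique {R M : Type*} [CommRing R] [AddCommGroup M] [Module R M]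
    {I : Ideal R} {e e' : ℕ → ℤ} (h : IsHilbertCoefficients R M I e)
    (h' : IsHilbertCoefficients R M I e') : e = e' := by
  have key := eq_zero_of_eventually_sum_choose (moduleDim R M)
    (fun k => (-1) ^ (moduleDim R M - k) * (e (moduleDim R M - k) - e' (moduleDim R M - k))) (by
      filter_upwards [h.2, h'.2] with n hn hn'
      have := sub_eq_zero.2 (hn.2.symm.trans hn'.2)
      rw [← Finset.sum_sub_distrib, ← Finset.sum_range_reflect] at this
      rw [← this]
      refine Finset.sum_congr rfl fun k hk => ?_
      have hk' : k ≤ moduleDim R M := by simpa [Nat.lt_succ_iff] using hk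
      have e1 : moduleDim R M + 1 - 1 - k = moduleDim R M - k := by omega
      have e2 : moduleDim R M - (moduleDim R M - k) = k := by omega
      rw [e1, e2]
      ring)
  funext i
  rcases lt_or_ge (moduleDim R M) i with hi | hi
  · rw [h.1 i hi, h'.1 i hi]
  · have := key (moduleDim R M - i) (by omega)
    have e2 : moduleDim R M - (moduleDim R M - i) = i := by omega
    simp only [e2, mul_eq_zero, pow_eq_zero_iff', neg_eq_zero, one_ne_zero, false_and,
      false_or, sub_eq_zero] at this
    exact this

open Classical in
/-- The `i`-th Hilbert coefficient `e_i(I, M)`; the value is `0` if the Hilbert function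
does not have the required form. `hilbertCoeff R R I 1` is the Chern number `e_1(I)`. -/
noncomputable def hilbertCoeff (R M : Type*) [CommRing R] [AddCommGroup M] [Module R M]
    (I : Ideal R) (i : ℕ) : ℤ :=
  if h : ∃ e : ℕ → ℤ, IsHilbertCoefficients R M I e then h.choose i else 0

theorem IsHilbertCoefficients.hilbertCoeff_eq {R M : Type*} [CommRing R] [AddCommGroup M]
    [Module R M] {I : Ideal R} {e : ℕ → ℤ} (h : IsHilbertCoefficients R M I e) (i : ℕ) :
    hilbertCoeff R M I i = e i := by
  have hex : ∃ e : ℕ → ℤ, IsHilbertCoefficients R M I e := ⟨e, h⟩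
  rw [hilbertCoeff, dif_pos hex, hex.choose_spec.unique h]

end LocalHilbert

/-! The ring is treated as a submodule of `E`, and the claim is widened so that induction on
dimension applies (`exists_eventuallyHilbert`). Let `M ⊆ E` with `depth E ≥ d`, and let `I` be
generated by `d` elements and primary to the maximal ideal modulo the annihilator of `E`. Then
`e₁(I, M) ≤ 0`, and equality forces `depth M ≥ d`. For `M = R`, equality would make `R`
Cohen–Macaulay.

Over an infinite residue field, a general generator `y` of `I` is superficial for `M`,
filter-regular on `C = E / M` (`exists_superficial`), and regular on `E`. Put `N = M ∩ yE`. The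
module `M' = M / N` embeds in `E / yE`, whose depth is at least `d - 1`, so the induction continues
with `M'` although `M / yM` need not embed. Filter-regularity on `C` makes `N / yM` of finite length
`l`. `eventually_length_quotient_pow_succ` gives, for large `n`, `λ(M/Iⁿ⁺¹M) - λ(M/IⁿM) = l +
λ(M'/Iⁿ⁺¹M')`, and `EventuallyHilbert.of_difference` sums it.

For `d = 1` one has `e₁ = 0`. For `d = 2` the recursion reads `e₁(M) = e₁(M') - l`, so `e₁(M) = 0`
forces `l = 0`, that is `N = yM`. For `d ≥ 3` it reads `e₁(M) = e₁(M')`; if this is zero, then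
`depth M' ≥ 2` by induction, and `comap_smul_top_le_of_depthGE` shows that `y` is regular on `C`, so
again `N = yM`. In both cases `M' = M / yM`, and depth lifts from `M'` to `M`.

The residue field is made infinite by passing to `R(t)`, which is faithfully flat over `R` and
preserves the lengths `λ(R/Jⁿ)`; regularity of the generators descends. -/

namespace LocalHilbert

open IsLocalRing Filter RingTheory.Sequence
open scoped Pointwise TensorProduct Polynomial

/-! ### Depth: independence of the regular sequence, and comparison with dimension -/

section Depth

/-- Used to show that `M / xM` has no socle as soon as the maximal ideal contains a regular sequence
`y, z` on `M`: the relations with `y` and `z` can be traded for divisibility by `x`. -/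
theorem mem_smul_top_of_isSMulRegular {R M : Type*} [CommRing R] [AddCommGroup M] [Module R M]
    {x y z : R} (hx : IsSMulRegular M x) (hy : IsSMulRegular M y)
    (hz : IsSMulRegular (QuotSMulTop y M) z) {v : M}
    (hyv : y • v ∈ x • (⊤ : Submodule R M)) (hzv : z • v ∈ x • (⊤ : Submodule R M)) :
    v ∈ x • (⊤ : Submodule R M) := by
  rw [Submodule.mem_smul_pointwise_iff_exists] at hyv hzv
  obtain ⟨a, -, ha⟩ := hyv
  obtain ⟨b, -, hb⟩ := hzv
  have h1 : z • a = y • b := hx (by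
    change x • z • a = x • y • b
    rw [smul_comm x z, smul_comm x y, ha, hb, smul_comm])
  have h2 : a ∈ y • (⊤ : Submodule R M) := by
    apply mem_of_isSMulRegular_quotient_of_smul_mem hz
    rw [h1]
    exact Submodule.smul_mem_pointwise_smul _ _ _ trivial
  rw [Submodule.mem_smul_pointwise_iff_exists] at h2
  obtain ⟨c, -, rfl⟩ := h2
  have h3 : v = x • c := hy (by
    change y • v = y • x • c
    rw [← ha, smul_comm])
  rw [h3]
  exact Submodule.smul_mem_pointwise_smul _ _ _ trivial

variable (R : Type*) [CommRing R] [IsLocalRing R]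

/-- There is a weakly `M`-regular sequence of length `n` in the maximal ideal. -/
def DepthGE (n : ℕ) (M : Type*) [AddCommGroup M] [Module R M] : Prop :=
  ∃ rs : List R, rs.length = n ∧ (∀ r ∈ rs, r ∈ maximalIdeal R) ∧ IsWeaklyRegular M rs

variable {R} {M : Type*} [AddCommGroup M] [Module R M]

theorem DepthGE.of_quotSMulTop {n : ℕ} {x : R} (hx : x ∈ maximalIdeal R)
    (hreg : IsSMulRegular M x) (h : DepthGE R n (QuotSMulTop x M)) : DepthGE R (n + 1) M := by
  obtain ⟨rs, rfl, hm, hrs⟩ := h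
  exact ⟨x :: rs, rfl, by simpa using ⟨hx, hm⟩, (isWeaklyRegular_cons_iff M x rs).2 ⟨hreg, hrs⟩⟩

theorem DepthGE.exists_quotSMulTop {n : ℕ} (h : DepthGE R (n + 1) M) :
    ∃ x ∈ maximalIdeal R, IsSMulRegular M x ∧ DepthGE R n (QuotSMulTop x M) := by
  obtain ⟨_ | ⟨x, rs⟩, hl, hm, hrs⟩ := h
  · simp at hl
  · rw [isWeaklyRegular_cons_iff] at hrs
    simp only [List.mem_cons, forall_eq_or_imp] at hm
    exact ⟨x, hm.1, hrs.1, rs, by simpa using hl, hm.2, hrs.2⟩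

theorem DepthGE.of_linearEquiv {N : Type*} [AddCommGroup N] [Module R N] {n : ℕ} (e : M ≃ₗ[R] N)
    (h : DepthGE R n M) : DepthGE R n N := by
  obtain ⟨rs, hl, hm, hrs⟩ := h
  exact ⟨rs, hl, hm, (e.isWeaklyRegular_congr rs).1 hrs⟩

variable [IsNoetherianRing R]

theorem exists_isSMulRegular_of_forall_smul_eq_zero [Module.Finite R M]
    (h : ∀ v : M, (∀ r ∈ maximalIdeal R, r • v = 0) → v = 0) :
    ∃ r ∈ maximalIdeal R, IsSMulRegular M r := by
  have hs : Subsingleton ((R ⧸ maximalIdeal R) →ₗ[R] M) := by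
    refine ⟨fun f g => ?_⟩
    refine LinearMap.ext fun u => ?_
    rw [← sub_eq_zero]
    refine h _ fun r hr => ?_
    rw [← LinearMap.sub_apply, ← map_smul]
    have : r • u = 0 := by
      obtain ⟨u, rfl⟩ := Ideal.Quotient.mk_surjective u
      rw [← Ideal.Quotient.mkₐ_eq_mk R, ← map_smul, Ideal.Quotient.mkₐ_eq_mk,
        Ideal.Quotient.eq_zero_iff_mem]
      exact Ideal.mul_mem_right _ _ hr
    rw [this, map_zero]
  obtain ⟨r, hr, hreg⟩ := IsSMulRegular.subsingleton_linearMap_iff.1 hs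
  exact ⟨r, by simpa [Ideal.annihilator_quotient] using hr, hreg⟩

/-- Neither quotient has a socle, so neither does their product; one regular element on the product
serves both factors. -/
theorem DepthGE.exists_isSMulRegular_pair [Module.Finite R M] {n : ℕ} (h : DepthGE R (n + 2) M)
    {x y : R} (hx : IsSMulRegular M x) (hy : IsSMulRegular M y) :
    ∃ z ∈ maximalIdeal R, IsSMulRegular (QuotSMulTop x M) z ∧
      IsSMulRegular (QuotSMulTop y M) z := by
  obtain ⟨a, ha, hareg, h⟩ := h.exists_quotSMulTop
  obtain ⟨b, hb, hbreg, -⟩ := h.exists_quotSMulTop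
  have key : ∀ w : R, IsSMulRegular M w → ∀ v : QuotSMulTop w M,
      (∀ r ∈ maximalIdeal R, r • v = 0) → v = 0 := by
    intro w hw v hv
    obtain ⟨v, rfl⟩ := Submodule.mkQ_surjective _ v
    have h1 : ∀ r ∈ maximalIdeal R, r • v ∈ w • (⊤ : Submodule R M) := by
      intro r hr
      have := hv r hr
      rwa [← map_smul, Submodule.mkQ_apply, Submodule.Quotient.mk_eq_zero] at this
    rw [Submodule.mkQ_apply, Submodule.Quotient.mk_eq_zero]
    exact mem_smul_top_of_isSMulRegular hw hareg hbreg (h1 a ha) (h1 b hb)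
  obtain ⟨z, hz, hreg⟩ := exists_isSMulRegular_of_forall_smul_eq_zero
    (M := QuotSMulTop x M × QuotSMulTop y M) (fun v hv => Prod.ext
      (key x hx _ fun r hr => congrArg Prod.fst (hv r hr))
      (key y hy _ fun r hr => congrArg Prod.snd (hv r hr)))
  exact ⟨z, hz, hreg.of_injective (LinearMap.inl R _ _) LinearMap.inl_injective,
    hreg.of_injective (LinearMap.inr R _ _) LinearMap.inr_injective⟩

/-- An exchange argument. If `y` starts a long regular sequence, choose `z` regular modulo both `x`
and `y`. Permuting regular sequences moves the depth from `M / yM` to `M / zM`, then by induction to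
`M / (z, x)M`, and finally to `M / xM`. -/
theorem DepthGE.quotSMulTop {n : ℕ} {x : R} [Module.Finite R M] (hx : x ∈ maximalIdeal R)
    (hreg : IsSMulRegular M x) (h : DepthGE R (n + 1) M) : DepthGE R n (QuotSMulTop x M) := by
  induction n generalizing M x with
  | zero => exact ⟨[], rfl, by simp, .nil R _⟩
  | succ n ih =>
    obtain ⟨y, hy, hyreg, hE⟩ := h.exists_quotSMulTop
    obtain ⟨z, hz, hzx, hzy⟩ := h.exists_isSMulRegular_pair hreg hyreg
    obtain ⟨rs, hl, hm, hrs⟩ := ih hz hzy hE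
    have h1 : IsWeaklyRegular M (z :: y :: rs) :=
      IsLocalRing.isWeaklyRegular_of_perm_of_subset_maximalIdeal (rs := y :: z :: rs)
        (by simpa only [isWeaklyRegular_cons_iff] using ⟨hyreg, hzy, hrs⟩) (.swap _ _ _)
        (by simpa using ⟨hy, hz, hm⟩)
    rw [isWeaklyRegular_cons_iff] at h1
    have h2 : IsWeaklyRegular M [z, x] :=
      IsLocalRing.isWeaklyRegular_of_perm_of_subset_maximalIdeal (rs := [x, z])
        (by simpa only [isWeaklyRegular_cons_iff] using ⟨hreg, hzx, .nil R _⟩) (.swap _ _ _)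
        (by simpa using ⟨hx, hz⟩)
    rw [isWeaklyRegular_cons_iff, isWeaklyRegular_singleton_iff] at h2
    obtain ⟨rs', hl', hm', hrs'⟩ :=
      ih hx h2.2 ⟨y :: rs, by simp [hl], by simpa using ⟨hy, hm⟩, h1.2⟩
    have h3 : IsWeaklyRegular M (x :: z :: rs') :=
      IsLocalRing.isWeaklyRegular_of_perm_of_subset_maximalIdeal (rs := z :: x :: rs')
        (by simpa only [isWeaklyRegular_cons_iff] using ⟨h1.1, h2.2, hrs'⟩) (.swap _ _ _)
        (by simpa using ⟨hz, hx, hm'⟩)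
    rw [isWeaklyRegular_cons_iff] at h3
    exact ⟨z :: rs', by simp [hl'], by simpa using ⟨hz, hm'⟩, h3.2⟩

/-- The strong form, for all nonzero submodules, excludes small submodules such as the kernel of a
parameter. In the induction, `N` cannot simply be reduced modulo `y`, since its image in `M / yM`
may vanish; it is first saturated with respect to `y`. -/
theorem DepthGE.le_supportDim [Module.Finite R M] {n : ℕ} (h : DepthGE R n M)
    (N : Submodule R M) (hN : N ≠ ⊥) : (n : WithBot ℕ∞) ≤ Module.supportDim R N := by
  induction n generalizing M with
  | zero =>
    have : Nontrivial N := (Submodule.nontrivial_iff_ne_bot).2 hN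
    have := Module.supportDim_ne_bot_of_nontrivial R N
    generalize Module.supportDim R N = t at *
    induction t with
    | bot => simp at this
    | coe t => simp
  | succ n ih =>
    obtain ⟨y, hy, hyreg, hE⟩ := h.exists_quotSMulTop
    have : IsNoetherian R M := isNoetherian_of_isNoetherianRing_of_finite R M
    let P : ℕ →o Submodule R M := ⟨fun k => N.comap (LinearMap.lsmul R M (y ^ k)), by
      refine monotone_nat_of_le_succ fun k v hv => ?_
      simp only [Submodule.mem_comap, LinearMap.lsmul_apply] at hv ⊢
      rw [pow_succ', mul_smul]
      exact N.smul_mem y hv⟩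
    obtain ⟨k, hk⟩ := monotone_stabilizes_iff_noetherian.2 this P
    have hNP : N ≤ P k := fun v hv => N.smul_mem _ hv
    have hdiv : ∀ v : M, y • v ∈ P k → v ∈ P k := by
      intro v hv
      rw [hk (k + 1) (by omega)]
      change y ^ (k + 1) • v ∈ N
      rw [pow_succ, mul_smul]
      exact hv
    -- If the saturation lay in `yM`, saturatedness would give `P = yP`, against Nakayama.
    have hPne : (P k).map (y • (⊤ : Submodule R M)).mkQ ≠ ⊥ := by
      intro h0
      have h1 : P k ≤ y • ⊤ := by
        rw [← Submodule.ker_mkQ (y • (⊤ : Submodule R M)), LinearMap.le_ker_iff_map]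
        exact h0
      have h2 : P k ≤ Ideal.span {y} • P k := by
        intro v hv
        obtain ⟨w, -, rfl⟩ := (Submodule.mem_smul_pointwise_iff_exists _ _ _).1 (h1 hv)
        exact Submodule.smul_mem_smul (Ideal.mem_span_singleton_self y) (hdiv w hv)
      have h3 := Submodule.eq_bot_of_le_smul_of_le_jacobson_bot (Ideal.span {y}) (P k)
        (IsNoetherian.noetherian _) h2 (by
          rw [IsLocalRing.jacobson_eq_maximalIdeal _ bot_ne_top]
          simpa [Ideal.span_le] using hy)
      exact hN (le_bot_iff.1 (h3 ▸ hNP))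
    have h1 := ih hE _ hPne
    have h2 : Module.supportDim R ((P k).map (y • (⊤ : Submodule R M)).mkQ) ≤
        Module.supportDim R (QuotSMulTop y (P k)) := by
      let g : QuotSMulTop y (P k) →ₗ[R] (P k).map (y • (⊤ : Submodule R M)).mkQ :=
        Submodule.liftQ _ ((y • (⊤ : Submodule R M)).mkQ.submoduleMap (P k)) (by
          intro v hv
          obtain ⟨w, -, rfl⟩ := (Submodule.mem_smul_pointwise_iff_exists _ _ _).1 hv
          rw [LinearMap.mem_ker]
          refine Subtype.ext ?_
          exact (Submodule.Quotient.mk_eq_zero _).2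
            (Submodule.smul_mem_pointwise_smul (w : M) y ⊤ trivial))
      refine Module.supportDim_le_of_surjective g fun v => ?_
      obtain ⟨w, hw⟩ := LinearMap.submoduleMap_surjective _ _ v
      exact ⟨Submodule.Quotient.mk w, hw⟩
    have h3 := Module.supportDim_quotSMulTop_succ_eq_supportDim
      (hyreg.submodule (P k)) hy
    have h4 : Module.supportDim R (P k) ≤ Module.supportDim R N := by
      refine Module.supportDim_le_of_injective
        (((LinearMap.lsmul R M (y ^ k)).restrict (p := P k) (q := N) fun v hv => hv)) ?_
      intro v w hvw
      refine Subtype.ext (hyreg.pow k ?_)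
      simpa using congrArg Subtype.val hvw
    calc ((n + 1 : ℕ) : WithBot ℕ∞) = n + 1 := by push_cast; rfl
      _ ≤ _ := by gcongr; exact h1.trans h2
      _ ≤ _ := h3 ▸ h4

theorem supportDim_le_length [Module.Finite R M] (xs : List R) (hxs : ∀ x ∈ xs, x ∈ maximalIdeal R)
    {K : ℕ} (hK : maximalIdeal R ^ K ≤ Ideal.ofList xs ⊔ Module.annihilator R M) :
    Module.supportDim R M ≤ xs.length := by
  induction xs generalizing M with
  | nil =>
    have : Subsingleton (Module.support R M) := by
      refine ⟨fun p q => Subtype.ext (PrimeSpectrum.ext ?_)⟩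
      have key : ∀ p : Module.support R M, p.1.asIdeal = maximalIdeal R := by
        intro p
        have h1 := Module.mem_support_iff_of_finite.1 p.2
        refine le_antisymm (le_maximalIdeal p.1.2.ne_top) (p.1.2.le_of_pow_le (n := K) ?_)
        exact hK.trans (by simpa using h1)
      rw [key p, key q]
    exact Order.krullDim_nonpos_of_subsingleton
  | cons x xs ih =>
    simp only [List.mem_cons, forall_eq_or_imp] at hxs
    refine (Module.supportDim_le_supportDim_quotSMulTop_succ hxs.1).trans ?_
    rw [List.length_cons, Nat.cast_succ]
    gcongr
    refine ih hxs.2 (hK.trans ?_)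
    rw [Ideal.ofList_cons]
    refine sup_le (sup_le ?_ le_sup_left) (le_sup_of_le_right ?_)
    · refine le_sup_of_le_right ?_
      rw [Ideal.span_le, Set.singleton_subset_iff]
      exact QuotSMulTop.mem_annihilator M x
    · exact LinearMap.annihilator_le_of_surjective _ (Submodule.mkQ_surjective _)

/-- The kernel of `x` is killed by `x`, so the remaining elements bound its dimension by
`xs.length`; a nonzero kernel would have dimension at least the depth, which is one more. -/
theorem DepthGE.isWeaklyRegular [Module.Finite R M] (xs : List R)
    (hxs : ∀ x ∈ xs, x ∈ maximalIdeal R) (h : DepthGE R xs.length M)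
    {K : ℕ} (hK : maximalIdeal R ^ K ≤ Ideal.ofList xs ⊔ Module.annihilator R M) :
    IsWeaklyRegular M xs := by
  induction xs generalizing M with
  | nil => exact .nil R _
  | cons x xs ih =>
    simp only [List.mem_cons, forall_eq_or_imp] at hxs
    have hreg : IsSMulRegular M x := by
      rw [isSMulRegular_iff_ker_lsmul_eq_bot]
      by_contra hne
      have h1 := h.le_supportDim _ hne
      have h2 := supportDim_le_length (M := LinearMap.ker (LinearMap.lsmul R M x)) xs hxs.2
        (K := K) (hK.trans (by
          rw [Ideal.ofList_cons]
          refine sup_le (sup_le ?_ le_sup_left) (le_sup_of_le_right ?_)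
          · refine le_sup_of_le_right ?_
            rw [Ideal.span_le, Set.singleton_subset_iff]
            exact Module.mem_annihilator.2 fun v => Subtype.ext v.2
          · exact LinearMap.annihilator_le_of_injective _ (Submodule.injective_subtype _)))
      have h3 := h1.trans h2
      rw [List.length_cons] at h3
      have : xs.length + 1 ≤ xs.length := by exact_mod_cast h3
      omega
    rw [isWeaklyRegular_cons_iff]
    refine ⟨hreg, ih hxs.2 (h.quotSMulTop hxs.1 hreg) (hK.trans ?_)⟩
    rw [Ideal.ofList_cons]
    refine sup_le (sup_le ?_ le_sup_left) (le_sup_of_le_right ?_)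
    · refine le_sup_of_le_right ?_
      rw [Ideal.span_le, Set.singleton_subset_iff]
      exact QuotSMulTop.mem_annihilator M x
    · exact LinearMap.annihilator_le_of_surjective _ (Submodule.mkQ_surjective _)

end Depth

/-! ### General elements: superficial and filter-regular -/

section Superficial

/-- Over a local ring with infinite residue field, a finitely generated module is not a finite
union of proper submodules. -/
theorem exists_notMem_of_finite_of_infinite_residueField {R F : Type*} [CommRing R] [IsLocalRing R]
    [Infinite (ResidueField R)] [AddCommGroup F] [Module R F] [Module.Finite R F]
    {𝒮 : Set (Submodule R F)} (hfin : 𝒮.Finite) (h𝒮 : ⊤ ∉ 𝒮) : ∃ v : F, ∀ N ∈ 𝒮, v ∉ N := by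
  by_contra! hcon
  have hcov : ⋃ N ∈ hfin.toFinset, ((id N : Submodule R F) : Set F) = Set.univ := by
    refine Set.eq_univ_of_forall fun v => ?_
    obtain ⟨N, hN, hv⟩ := hcon v
    exact Set.mem_biUnion (by simpa using hN) hv
  -- B. H. Neumann's lemma: some member of a finite cover by subgroups has finite index. A simple
  -- quotient of the resulting finite module is the residue field.
  obtain ⟨N, hN, hidx⟩ := Submodule.exists_finiteIndex_of_cover hcov
  have hNtop : N ≠ ⊤ := fun h => h𝒮 (h ▸ by simpa using hN)
  obtain ⟨P, hP, hNP⟩ := (eq_top_or_exists_le_coatom N).resolve_left hNtop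
  have : Finite (F ⧸ N) := by
    have := hidx
    exact AddSubgroup.finite_quotient_of_finiteIndex (H := (id N).toAddSubgroup)
  have : Finite (F ⧸ P) :=
    Finite.of_surjective (Submodule.factor hNP) (Submodule.factor_surjective hNP)
  have hsimple : IsSimpleModule R (F ⧸ P) := isSimpleModule_iff_isCoatom.2 hP
  obtain ⟨m, hm, ⟨e⟩⟩ := isSimpleModule_iff_quot_maximal.1 hsimple
  obtain rfl := eq_maximalIdeal hm
  have : Finite (ResidueField R) := Finite.of_equiv _ e.toEquiv
  exact not_finite (ResidueField R)

/-- A generic linear combination of `ξ` annihilates only elements annihilated by a power of the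
ideal generated by `ξ`. -/
theorem exists_finite_submodules_pow_smul_eq_zero (R : Type*) {B N ι : Type*} [CommRing R]
    [CommRing B] [IsNoetherianRing B] [Algebra R B] [AddCommGroup N] [Module B N]
    [Module.Finite B N] [Fintype ι] (ξ : ι → B) :
    ∃ 𝒮 : Set (Submodule R (ι → R)), 𝒮.Finite ∧ ⊤ ∉ 𝒮 ∧ ∀ a : ι → R, (∀ P ∈ 𝒮, a ∉ P) →
      ∃ c : ℕ, ∀ v : N, (∑ i, a i • ξ i) • v = 0 →
        ∀ b ∈ Ideal.span (Set.range ξ) ^ c, b • v = 0 := by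
  classical
  let L : (ι → R) →ₗ[R] B := Fintype.linearCombination R ξ
  refine ⟨(fun P : Ideal B => (P.restrictScalars R).comap L) ''
    {P ∈ associatedPrimes B N | ¬ Ideal.span (Set.range ξ) ≤ P},
    ((associatedPrimes.finite B N).subset (Set.sep_subset _ _)).image _, ?_, ?_⟩
  · rintro ⟨P, ⟨-, hP⟩, htop⟩
    refine hP (Ideal.span_le.2 ?_)
    rintro _ ⟨i, rfl⟩
    have : (Pi.single i 1 : ι → R) ∈ (P.restrictScalars R).comap L := by
      simp only at htop
      rw [htop]; trivial
    simpa [L] using this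
  · intro a ha
    let K : Submodule B N := LinearMap.ker (LinearMap.lsmul B N (∑ i, a i • ξ i))
    -- Minimal primes over the annihilator of the kernel are associated primes of `N` containing the
    -- general element. Having avoided all those that do not contain the `ξ i`, only primes
    -- containing them remain.
    have hrad : Ideal.span (Set.range ξ) ≤ (Module.annihilator B K).radical := by
      rw [← Ideal.sInf_minimalPrimes]
      refine le_sInf fun P hP => ?_
      have hass := Module.associatedPrimes.minimalPrimes_annihilator_subset_associatedPrimes B K hP
      have hassN : P ∈ associatedPrimes B N :=
        IsAssociatedPrime.map_of_injective K.subtype hass K.injective_subtype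
      by_contra hle
      refine ha _ ⟨P, ⟨hassN, hle⟩, rfl⟩ ?_
      have : (∑ i, a i • ξ i) ∈ P := hP.1.2 (Module.mem_annihilator.2 fun v => Subtype.ext v.2)
      simpa [L, Fintype.linearCombination_apply] using this
    obtain ⟨c, hc⟩ := Ideal.exists_pow_le_of_le_radical_of_fg hrad (IsNoetherian.noetherian _)
    refine ⟨c, fun v hv b hb => ?_⟩
    exact congrArg Subtype.val (Module.mem_annihilator.1 (hc hb) (⟨v, hv⟩ : K))

/-- The kernel of a general element on `P / T` is killed by a power of the ideal, and Artin–Rees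
then makes it meet high powers of the ideal trivially. -/
theorem exists_finite_submodules_mem_of_smul_mem (R : Type*) {B V ι : Type*} [CommRing R]
    [CommRing B] [IsNoetherianRing B] [Algebra R B] [AddCommGroup V] [Module B V] [Fintype ι]
    (ξ : ι → B) (P T : Submodule B V) (hP : P.FG) :
    ∃ 𝒮 : Set (Submodule R (ι → R)), 𝒮.Finite ∧ ⊤ ∉ 𝒮 ∧ ∀ a : ι → R, (∀ Q ∈ 𝒮, a ∉ Q) →
      ∃ c : ℕ, ∀ n ≥ c, ∀ v ∈ Ideal.span (Set.range ξ) ^ n • P,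
        (∑ i, a i • ξ i) • v ∈ T → v ∈ T := by
  have : Module.Finite B P := Module.Finite.iff_fg.2 hP
  let T' : Submodule B P := T.comap P.subtype
  obtain ⟨𝒮, hfin, htop, h𝒮⟩ := exists_finite_submodules_pow_smul_eq_zero R (N := P ⧸ T') ξ
  refine ⟨𝒮, hfin, htop, fun a ha => ?_⟩
  obtain ⟨c, hc⟩ := h𝒮 a ha
  set A := Ideal.span (Set.range ξ)
  let K : Submodule B (P ⧸ T') := LinearMap.ker (LinearMap.lsmul B _ (∑ i, a i • ξ i))
  obtain ⟨k, hk⟩ := Ideal.exists_pow_inf_eq_pow_smul A K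
  refine ⟨c + k, fun n hn v hv hvT => ?_⟩
  have hvP : v ∈ P := Submodule.smul_le_right hv
  have h1 : T'.mkQ ⟨v, hvP⟩ ∈ A ^ n • (⊤ : Submodule B (P ⧸ T')) := by
    have h2 : (⟨v, hvP⟩ : P) ∈ A ^ n • (⊤ : Submodule B P) := by
      rw [← Submodule.range_subtype P, ← Submodule.map_top, ← Submodule.map_smul''] at hv
      obtain ⟨u, hu, rfl⟩ := hv
      exact hu
    have h3 := Submodule.mem_map_of_mem (f := T'.mkQ) h2
    rwa [Submodule.map_smul'', Submodule.map_top, Submodule.range_mkQ] at h3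
  have h2 : T'.mkQ ⟨v, hvP⟩ ∈ K := by
    rw [LinearMap.mem_ker, LinearMap.lsmul_apply, ← map_smul, Submodule.mkQ_apply,
      Submodule.Quotient.mk_eq_zero]
    exact hvT
  have h3 : T'.mkQ ⟨v, hvP⟩ ∈ A ^ n • ⊤ ⊓ K := ⟨h1, h2⟩
  have h4 : A ^ (n - k) • (A ^ k • ⊤ ⊓ K) ≤ ⊥ := by
    rw [Submodule.smul_le]
    intro b hb w hw
    exact hc w hw.2 b (Ideal.pow_le_pow_right (by omega) hb)
  rw [hk n (by omega)] at h3
  have h5 := h4 h3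
  rw [Submodule.mem_bot, Submodule.mkQ_apply, Submodule.Quotient.mk_eq_zero] at h5
  exact h5

variable {R M : Type*} [CommRing R] [AddCommGroup M] [Module R M]

/-- The filtration `I ^ (n + k) M`. -/
def shiftedFiltration (M : Type*) [AddCommGroup M] [Module R M] (I : Ideal R) (k : ℕ) :
    I.Filtration M where
  N n := I ^ (n + k) • ⊤
  mono n := Submodule.smul_mono_left (Ideal.pow_le_pow_right (by omega))
  smul_le n := by
    rw [← mul_smul, ← pow_succ']
    exact Submodule.smul_mono_left (Ideal.pow_le_pow_right (by omega))

theorem smul_mem_pow_succ_smul {I : Ideal R} {N : Submodule R M} {n : ℕ} {r : R} {v : M}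
    (hr : r ∈ I) (hv : v ∈ I ^ n • N) : r • v ∈ I ^ (n + 1) • N := by
  rw [pow_succ', mul_smul]
  exact Submodule.smul_mem_smul hr hv

theorem exists_eq_sum_of_mem_span_range_smul {ι : Type*} [Fintype ι] (x : ι → R) (N : Submodule R M) {z : M}
    (hz : z ∈ Ideal.span (Set.range x) • N) : ∃ w : ι → M, (∀ i, w i ∈ N) ∧ z = ∑ i, x i • w i := by
  classical
  refine Submodule.smul_induction_on hz ?_ ?_
  · intro r hr v hv
    obtain ⟨c, rfl⟩ := Ideal.mem_span_range_iff_exists_fun.1 hr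
    refine ⟨fun i => c i • v, fun i => N.smul_mem _ hv, ?_⟩
    rw [Finset.sum_smul]
    exact Finset.sum_congr rfl fun i _ => by rw [mul_comm, mul_smul]
  · rintro _ _ ⟨w, hw, rfl⟩ ⟨w', hw', rfl⟩
    exact ⟨w + w', fun i => N.add_mem (hw i) (hw' i), by simp [Finset.sum_add_distrib]⟩

/-- The previous lemma over the Rees algebra, with `ξ i = x i t`: the Rees module modulo its shift
is the associated graded module, so a general degree-one form is regular on it in large degrees. -/
theorem exists_finite_submodules_superficial [IsNoetherianRing R] [Module.Finite R M]
    {ι : Type*} [Fintype ι] (x : ι → R) :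
    ∃ 𝒮 : Set (Submodule R (ι → R)), 𝒮.Finite ∧ ⊤ ∉ 𝒮 ∧ ∀ a : ι → R, (∀ P ∈ 𝒮, a ∉ P) →
      ∃ c : ℕ, ∀ n ≥ c, ∀ z ∈ Ideal.span (Set.range x) ^ n • (⊤ : Submodule R M),
        (∑ i, a i * x i) • z ∈ Ideal.span (Set.range x) ^ (n + 2) • (⊤ : Submodule R M) →
        z ∈ Ideal.span (Set.range x) ^ (n + 1) • (⊤ : Submodule R M) := by
  set I := Ideal.span (Set.range x) with hI
  let F := shiftedFiltration M I 0
  let F' := shiftedFiltration M I 1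
  have hF : F.submodule.FG := by
    rw [Ideal.Filtration.submodule_fg_iff_stable _ (fun i => IsNoetherian.noetherian _)]
    refine ⟨0, fun n _ => ?_⟩
    change I • I ^ (n + 0) • (⊤ : Submodule R M) = I ^ (n + 1 + 0) • ⊤
    rw [← mul_smul, ← pow_succ']
  let ξ : ι → reesAlgebra I := fun i => ⟨Polynomial.monomial 1 (x i),
    reesAlgebra.monomial_mem.2 (by simpa using Ideal.subset_span (Set.mem_range_self i))⟩
  obtain ⟨𝒮, hfin, htop, h𝒮⟩ :=
    exists_finite_submodules_mem_of_smul_mem R ξ F.submodule F'.submodule hF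
  refine ⟨𝒮, hfin, htop, fun a ha => ?_⟩
  obtain ⟨c, hc⟩ := h𝒮 a ha
  have hsingle : ∀ n, ∀ z ∈ I ^ n • (⊤ : Submodule R M), PolynomialModule.single R n z ∈
      Ideal.span (Set.range ξ) ^ n • F.submodule := by
    intro n
    induction n with
    | zero =>
      intro z hz
      rw [pow_zero, Ideal.one_eq_top, Submodule.top_smul]
      intro i
      rcases eq_or_ne i 0 with rfl | hi
      · simp [F, shiftedFiltration]
      · simp [hi.symm]
    | succ n ih =>
      intro z hz
      rw [pow_succ', mul_smul] at hz
      obtain ⟨w, hw, rfl⟩ := exists_eq_sum_of_mem_span_range_smul x _ hz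
      have : PolynomialModule.single R (n + 1) (∑ i, x i • w i) =
          ∑ i, ξ i • PolynomialModule.single R n (w i) := by
        have h2 : ∀ i, ξ i • PolynomialModule.single R n (w i) =
            PolynomialModule.single R (n + 1) (x i • w i) := by
          intro i
          rw [add_comm n 1]
          exact PolynomialModule.monomial_smul_single 1 (x i) n (w i)
        simp only [h2]
        exact map_sum (PolynomialModule.lsingle R (n + 1)) _ _
      rw [this]
      exact Submodule.sum_mem _ fun i _ => smul_mem_pow_succ_smul
        (Ideal.subset_span (Set.mem_range_self i)) (ih _ (hw i))
  refine ⟨c, fun n hn z hz hxz => ?_⟩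
  have h1 := hc n hn _ (hsingle n z hz) (by
    have : (∑ i, a i • ξ i) • PolynomialModule.single R n z =
        PolynomialModule.single R (n + 1) ((∑ i, a i * x i) • z) := by
      have h2 : ((∑ i, a i • ξ i : reesAlgebra I) : Polynomial R) =
          Polynomial.monomial 1 (∑ i, a i * x i) := by
        simp [ξ, Polynomial.smul_monomial]
      rw [add_comm n 1, ← PolynomialModule.monomial_smul_single, ← h2]
      rfl
    rw [this]
    intro i
    rcases eq_or_ne i (n + 1) with rfl | hi
    · simpa [F', shiftedFiltration] using hxz
    · simp [hi.symm])
  simpa [F', shiftedFiltration] using h1 n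

/-- If the leading form of a regular element `y` is regular on the associated graded module in
large degrees, then `(I ^ (n + 1) M : y) = I ^ n M` for large `n`. -/
theorem eventually_mem_pow_smul_of_smul_mem [IsNoetherianRing R] [Module.Finite R M] (I : Ideal R)
    {y : R} (hy : IsSMulRegular M y) {c : ℕ}
    (hc : ∀ n ≥ c, ∀ z ∈ I ^ n • (⊤ : Submodule R M), y • z ∈ I ^ (n + 2) • (⊤ : Submodule R M) →
      z ∈ I ^ (n + 1) • (⊤ : Submodule R M)) :
    ∀ᶠ n in atTop, ∀ z : M, y • z ∈ I ^ (n + 1) • (⊤ : Submodule R M) →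
      z ∈ I ^ n • (⊤ : Submodule R M) := by
  obtain ⟨k, hk⟩ := Ideal.exists_pow_inf_eq_pow_smul I (y • (⊤ : Submodule R M))
  refine eventually_atTop.2 ⟨c + k, fun n hn z hz => ?_⟩
  -- Artin–Rees for `yM`, followed by cancelling `y`, loses only a bounded number of powers of `I`;
  -- superficiality recovers them one at a time.
  have h1 : z ∈ I ^ (n + 1 - k) • (⊤ : Submodule R M) := by
    have h2 : y • z ∈ I ^ (n + 1) • ⊤ ⊓ y • (⊤ : Submodule R M) :=
      ⟨hz, Submodule.smul_mem_pointwise_smul _ _ _ trivial⟩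
    rw [hk _ (by omega)] at h2
    have h3 := Submodule.smul_mono le_rfl
      (inf_le_right : I ^ k • ⊤ ⊓ y • (⊤ : Submodule R M) ≤ _) h2
    have h4 : I ^ (n + 1 - k) • y • (⊤ : Submodule R M) = y • I ^ (n + 1 - k) • ⊤ :=
      (Submodule.map_smul'' _ _ _).symm
    rw [h4, Submodule.mem_smul_pointwise_iff_exists] at h3
    obtain ⟨w, hw, hwz⟩ := h3
    rwa [← hy hwz]
  have h2 : ∀ m, n + 1 - k ≤ m → m ≤ n + 1 → m ≤ n → z ∈ I ^ m • (⊤ : Submodule R M) := by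
    intro m hm
    induction m, hm using Nat.le_induction with
    | base => exact fun _ _ => h1
    | succ m hm ih =>
      intro h3 h4
      refine hc m (by omega) z (ih (by omega) (by omega)) ?_
      exact Submodule.smul_mono_left (Ideal.pow_le_pow_right (by omega)) hz
  rcases le_or_gt (n + 1 - k) n with h | h
  · exact h2 n h (by omega) le_rfl
  · exact Submodule.smul_mono_left (Ideal.pow_le_pow_right (by omega)) h1

end Superficial

/-! ### Lengths of quotients and the recursion for the Hilbert function -/

section Length

variable {R M : Type*} [CommRing R] [AddCommGroup M] [Module R M]

theorem length_ne_top_of_pow_maximalIdeal_le_annihilator [IsLocalRing R] [IsNoetherianRing R]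
    [Module.Finite R M] {K : ℕ} (hK : maximalIdeal R ^ K ≤ Module.annihilator R M) :
    Module.length R M ≠ ⊤ := by
  rcases subsingleton_or_nontrivial M with h | h
  · simp [Module.length_eq_zero]
  have hne : Module.annihilator R M ≠ ⊤ := by
    rw [Ne, Module.annihilator_eq_top_iff]
    exact not_subsingleton M
  have : Nontrivial (R ⧸ Module.annihilator R M) := Ideal.Quotient.nontrivial_iff.2 hne
  have : IsLocalRing (R ⧸ Module.annihilator R M) :=
    .of_surjective' (Ideal.Quotient.mk _) Ideal.Quotient.mk_surjective
  have hart : IsArtinianRing (R ⧸ Module.annihilator R M) := by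
    rw [isArtinianRing_iff_isNilpotent_maximalIdeal]
    refine ⟨K, ?_⟩
    rw [← IsLocalRing.map_maximalIdeal_of_surjective (Ideal.Quotient.mk (Module.annihilator R M))
      Ideal.Quotient.mk_surjective, ← Ideal.map_pow, Ideal.zero_eq_bot, Ideal.map_eq_bot_iff_le_ker,
      Ideal.mk_ker]
    exact hK
  let : Module (R ⧸ Module.annihilator R M) M := Module.quotientAnnihilator
  have : IsScalarTower R (R ⧸ Module.annihilator R M) M :=
    (Module.isTorsionBySet_annihilator R M).isScalarTower
  have : Module.Finite (R ⧸ Module.annihilator R M) M := Module.Finite.of_restrictScalars_finite R _ _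
  have h1 : IsArtinian (R ⧸ Module.annihilator R M) M := inferInstance
  have : IsArtinian R M :=
    (isArtinian_of_surjective_algebraMap (S := R) (R := R ⧸ Module.annihilator R M)
      Ideal.Quotient.mk_surjective)
  have : IsNoetherian R M := isNoetherian_of_isNoetherianRing_of_finite R M
  exact Module.length_ne_top

theorem pow_mul_le_pow_sup {J I A : Ideal R} {K : ℕ} (hK : J ^ K ≤ I ⊔ A) (n : ℕ) :
    J ^ (K * (n + 1)) ≤ I ^ n ⊔ A := by
  rw [pow_mul]
  refine (Ideal.pow_right_mono hK _).trans (Ideal.sup_pow_add_le_pow_sup_pow.trans ?_)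
  rw [pow_one]

theorem length_ne_top_of_pow_le_annihilator [IsLocalRing R] [IsNoetherianRing R]
    [Module.Finite R M] {K n : ℕ} {I : Ideal R}
    (hK : maximalIdeal R ^ K ≤ I ⊔ Module.annihilator R M) (hI : I ^ n ≤ Module.annihilator R M) :
    Module.length R M ≠ ⊤ := by
  refine length_ne_top_of_pow_maximalIdeal_le_annihilator (K := K * (n + 1)) ?_
  exact (pow_mul_le_pow_sup hK n).trans (sup_le hI le_rfl)

theorem pow_le_annihilator_quotient (I : Ideal R) (n : ℕ) :
    I ^ n ≤ Module.annihilator R (M ⧸ (I ^ n • ⊤ : Submodule R M)) := by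
  intro r hr
  rw [Module.mem_annihilator]
  intro v
  obtain ⟨v, rfl⟩ := Submodule.mkQ_surjective _ v
  rw [← map_smul, Submodule.mkQ_apply, Submodule.Quotient.mk_eq_zero]
  exact Submodule.smul_mem_smul hr trivial

theorem length_quotient_pow_smul_ne_top [IsLocalRing R] [IsNoetherianRing R]
    [Module.Finite R M] {K : ℕ} {I : Ideal R}
    (hK : maximalIdeal R ^ K ≤ I ⊔ Module.annihilator R M) (n : ℕ) :
    Module.length R (M ⧸ (I ^ n • ⊤ : Submodule R M)) ≠ ⊤ :=
  length_ne_top_of_pow_le_annihilator (hK.trans (sup_le_sup_left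
    (LinearMap.annihilator_le_of_surjective _ (Submodule.mkQ_surjective _)) I))
    (pow_le_annihilator_quotient I n)

theorem length_quotient_eq_add_of_comap_eq (g : M →ₗ[R] M) (A B : Submodule R M)
    (h : B.comap g = A) :
    Module.length R (M ⧸ B) = Module.length R (M ⧸ A) + Module.length R (M ⧸ (B ⊔ g.range)) := by
  refine Module.length_eq_add_of_exact (A.mapQ B g h.ge) (Submodule.factor le_sup_left) ?_
    (Submodule.factor_surjective _) ?_
  · rw [← LinearMap.ker_eq_bot, LinearMap.ker_eq_bot']
    intro v hv
    obtain ⟨v, rfl⟩ := Submodule.mkQ_surjective _ v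
    rw [Submodule.mkQ_apply, Submodule.mapQ_apply, Submodule.Quotient.mk_eq_zero] at hv
    rw [Submodule.mkQ_apply, Submodule.Quotient.mk_eq_zero, ← h]
    exact hv
  · intro v
    obtain ⟨v, rfl⟩ := Submodule.mkQ_surjective _ v
    have h1 : Submodule.factor (le_sup_left : B ≤ B ⊔ g.range) (B.mkQ v) =
        (B ⊔ g.range).mkQ v := rfl
    rw [h1, Submodule.mkQ_apply, Submodule.Quotient.mk_eq_zero, Submodule.mem_sup]
    constructor
    · rintro ⟨b, hb, -, ⟨w, rfl⟩, rfl⟩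
      refine ⟨Submodule.Quotient.mk w, ?_⟩
      rw [Submodule.mapQ_apply, map_add, Submodule.mkQ_apply, Submodule.mkQ_apply,
        (Submodule.Quotient.mk_eq_zero B).2 hb, zero_add]
    · rintro ⟨w, hw⟩
      obtain ⟨w, rfl⟩ := Submodule.mkQ_surjective _ w
      rw [Submodule.mkQ_apply, Submodule.mapQ_apply, Submodule.mkQ_apply, eq_comm,
        Submodule.Quotient.eq] at hw
      exact ⟨v - g w, hw, g w, ⟨w, rfl⟩, by abel⟩

theorem length_quotient_sup_eq_add (B S T : Submodule R M) (hTS : T ≤ S)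
    (h : S ⊓ (B ⊔ T) ≤ T) :
    Module.length R (M ⧸ (B ⊔ T)) =
      Module.length R (S ⧸ T.comap S.subtype) + Module.length R (M ⧸ (B ⊔ S)) := by
  have hle : T.comap S.subtype ≤ (B ⊔ T).comap S.subtype := Submodule.comap_mono le_sup_right
  have hle' : B ⊔ T ≤ B ⊔ S := sup_le_sup_left hTS B
  refine Module.length_eq_add_of_exact (Submodule.mapQ _ (B ⊔ T) S.subtype hle)
    (Submodule.factor hle') ?_ (Submodule.factor_surjective _) ?_
  · rw [← LinearMap.ker_eq_bot, LinearMap.ker_eq_bot']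
    intro v hv
    obtain ⟨v, rfl⟩ := Submodule.mkQ_surjective _ v
    rw [Submodule.mkQ_apply, Submodule.mapQ_apply, Submodule.Quotient.mk_eq_zero] at hv
    rw [Submodule.mkQ_apply, Submodule.Quotient.mk_eq_zero]
    exact h ⟨v.2, hv⟩
  · intro v
    obtain ⟨v, rfl⟩ := Submodule.mkQ_surjective _ v
    have h1 : Submodule.factor hle' ((B ⊔ T).mkQ v) = (B ⊔ S).mkQ v := rfl
    rw [h1, Submodule.mkQ_apply, Submodule.Quotient.mk_eq_zero, Submodule.mem_sup]
    constructor
    · rintro ⟨b, hb, s, hs, rfl⟩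
      refine ⟨Submodule.Quotient.mk ⟨s, hs⟩, ?_⟩
      rw [Submodule.mapQ_apply, Submodule.mkQ_apply, Submodule.Quotient.eq]
      simpa using (Submodule.mem_sup_left hb : b ∈ B ⊔ T)
    · rintro ⟨w, hw⟩
      obtain ⟨w, rfl⟩ := Submodule.mkQ_surjective _ w
      rw [Submodule.mkQ_apply, Submodule.mapQ_apply, Submodule.mkQ_apply, eq_comm,
        Submodule.Quotient.eq] at hw
      obtain ⟨b, hb, t, ht, hbt⟩ := Submodule.mem_sup.1 hw
      refine ⟨b, hb, w + t, S.add_mem w.2 (hTS ht), ?_⟩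
      have : v = b + t + w := by rw [hbt]; simp
      rw [this]; abel

theorem length_quotient_quotient_pow_smul (I : Ideal R) (n : ℕ) (N : Submodule R M) :
    Module.length R ((M ⧸ N) ⧸ (I ^ n • ⊤ : Submodule R (M ⧸ N))) =
      Module.length R (M ⧸ (I ^ n • ⊤ ⊔ N : Submodule R M)) := by
  have h1 : (I ^ n • ⊤ : Submodule R (M ⧸ N)) = (I ^ n • ⊤ : Submodule R M).map N.mkQ := by
    rw [Submodule.map_smul'', Submodule.map_top, Submodule.range_mkQ]
  rw [h1, sup_comm]
  exact (Submodule.quotientQuotientEquivQuotientSup N _).length_eq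

/-- The recursion satisfied by the Hilbert function under passage to the quotient by a
superficial element. -/
theorem eventually_length_quotient_pow_succ [IsNoetherianRing R] [Module.Finite R M] (I : Ideal R)
    {y : R} {N : Submodule R M} (hyN : y • ⊤ ≤ N) {c : ℕ}
    (hc : I ^ c • N ≤ y • (⊤ : Submodule R M)) (hyI : y ∈ I)
    (hsup : ∀ᶠ n in atTop, ∀ z : M, y • z ∈ I ^ (n + 1) • (⊤ : Submodule R M) →
      z ∈ I ^ n • (⊤ : Submodule R M)) :
    ∀ᶠ n in atTop, Module.length R (M ⧸ (I ^ (n + 1) • ⊤ : Submodule R M)) =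
      Module.length R (M ⧸ (I ^ n • ⊤ : Submodule R M)) +
      (Module.length R (N ⧸ (y • (⊤ : Submodule R M)).comap N.subtype) +
        Module.length R ((M ⧸ N) ⧸ (I ^ (n + 1) • ⊤ : Submodule R (M ⧸ N)))) := by
  obtain ⟨k, hk⟩ := Ideal.exists_pow_inf_eq_pow_smul I N
  filter_upwards [hsup, eventually_ge_atTop (k + c)] with n hn hkn
  have hrange : (LinearMap.lsmul R M y).range = y • (⊤ : Submodule R M) :=
    LinearMap.range_eq_map _
  rw [length_quotient_quotient_pow_smul, ← length_quotient_sup_eq_add _ _ _ hyN, ← hrange]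
  · refine length_quotient_eq_add_of_comap_eq _ _ _ (le_antisymm (fun z hz => hn z hz) ?_)
    intro z hz
    exact smul_mem_pow_succ_smul hyI hz
  -- By Artin–Rees, `Iⁿ⁺¹M ∩ N ⊆ Iᶜ N ⊆ yM` once `n + 1 - k ≥ c`; hence `N / yM` is fully visible
  -- modulo `Iⁿ⁺¹M`.
  · rintro v ⟨hvN, hv⟩
    obtain ⟨u, hu, w, hw, rfl⟩ := Submodule.mem_sup.1 hv
    have h1 : u ∈ I ^ (n + 1) • ⊤ ⊓ N :=
      ⟨hu, by simpa using N.sub_mem hvN (hyN hw)⟩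
    rw [hk _ (by omega)] at h1
    refine add_mem (hc ?_) hw
    exact Submodule.smul_mono (Ideal.pow_le_pow_right (by omega)) inf_le_right h1

theorem sup_span_singleton_pow_smul_top {y : R} (hy : y ∈ Module.annihilator R M) (A : Ideal R)
    (n : ℕ) : ((Ideal.span {y} ⊔ A) ^ n • ⊤ : Submodule R M) = A ^ n • ⊤ := by
  induction n with
  | zero => simp
  | succ n ih =>
    rw [pow_succ', mul_smul, ih, Submodule.sup_smul, pow_succ', mul_smul, sup_eq_right]
    rw [Submodule.smul_le]
    intro r hr v _
    obtain ⟨a, rfl⟩ := Ideal.mem_span_singleton'.1 hr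
    rw [mul_smul, Module.mem_annihilator.1 hy, smul_zero]
    exact zero_mem _

end Length

/-! ### Summing Hilbert polynomials -/

section Sum

/-- `h n` agrees for large `n` with the Hilbert polynomial with coefficients `e 0, …, e d`. -/
def EventuallyHilbert (h : ℕ → ℤ) (d : ℕ) (e : ℕ → ℤ) : Prop :=
  ∀ᶠ n : ℕ in atTop, h n = ∑ i ∈ Finset.range (d + 1),
    (-1) ^ i * e i * ((n + (d - i) - 1).choose (d - i) : ℤ)

/-- Pascal's rule makes summation raise each binomial degree by one without moving the index of its
coefficient. The constant `l` joins the degree-zero term, of index `d` and sign `(-1) ^ d`; the new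
last coefficient is the constant of summation. -/
theorem EventuallyHilbert.of_difference {h h' : ℕ → ℤ} {d : ℕ} {e' : ℕ → ℤ} {l : ℤ}
    (hh' : EventuallyHilbert h' d e') (hd : ∀ᶠ n in atTop, h (n + 1) = h n + (l + h' (n + 1))) :
    ∃ e : ℕ → ℤ, EventuallyHilbert h (d + 1) e ∧ (∀ i < d, e i = e' i) ∧
      e d = e' d + (-1) ^ d * l := by
  let ε : ℕ → ℤ := fun i => if i < d then e' i else e' d + (-1) ^ d * l
  let g : ℕ → ℤ := fun n => ∑ i ∈ Finset.range (d + 1),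
    (-1) ^ i * ε i * ((n + (d + 1 - i) - 1).choose (d + 1 - i) : ℤ)
  have hεlt : ∀ i < d, ε i = e' i := fun i hi => if_pos hi
  have hεd : ε d = e' d + (-1) ^ d * l := if_neg (lt_irrefl d)
  have hg : ∀ n, g (n + 1) - g n = l + ∑ i ∈ Finset.range (d + 1),
      (-1) ^ i * e' i * ((n + 1 + (d - i) - 1).choose (d - i) : ℤ) := by
    intro n
    have h1 : g (n + 1) - g n = ∑ i ∈ Finset.range (d + 1),
        (-1) ^ i * ε i * ((n + 1 + (d - i) - 1).choose (d - i) : ℤ) := by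
      simp only [g]
      rw [← Finset.sum_sub_distrib]
      refine Finset.sum_congr rfl fun i hi => ?_
      have hi' : i ≤ d := by simpa [Nat.lt_succ_iff] using hi
      obtain ⟨j, rfl⟩ := Nat.exists_eq_add_of_le hi'
      have e1 : n + 1 + (i + j + 1 - i) - 1 = (n + j) + 1 := by omega
      have e2 : n + (i + j + 1 - i) - 1 = n + j := by omega
      have e3 : n + 1 + (i + j - i) - 1 = n + j := by omega
      have e4 : i + j + 1 - i = j + 1 := by omega
      have e5 : i + j - i = j := by omega
      rw [e1, e2, e3, e4, e5, Nat.choose_succ_succ]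
      push_cast
      ring
    rw [h1, Finset.sum_range_succ, Finset.sum_range_succ, hεd]
    have h2 : ∑ i ∈ Finset.range d, (-1) ^ i * ε i * ((n + 1 + (d - i) - 1).choose (d - i) : ℤ) =
        ∑ i ∈ Finset.range d, (-1) ^ i * e' i * ((n + 1 + (d - i) - 1).choose (d - i) : ℤ) :=
      Finset.sum_congr rfl fun i hi => by rw [hεlt i (by simpa using hi)]
    have h3 : ((-1 : ℤ) ^ d) * (-1) ^ d = 1 := by rw [← mul_pow]; simp
    rw [h2]
    simp only [Nat.sub_self, Nat.choose_zero_right, Nat.cast_one]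
    linear_combination l * h3
  obtain ⟨n₀, hn₀⟩ := eventually_atTop.1 (hd.and ((tendsto_add_atTop_nat 1).eventually hh'))
  have hconst : ∀ n ≥ n₀, h n = g n + (h n₀ - g n₀) := by
    intro n hn
    induction n, hn using Nat.le_induction with
    | base => ring
    | succ n hn ih =>
      obtain ⟨h1, h2⟩ := hn₀ n hn
      have := hg n
      linarith
  refine ⟨fun i => if i ≤ d then ε i else (-1) ^ (d + 1) * (h n₀ - g n₀), ?_, ?_, ?_⟩
  · refine eventually_atTop.2 ⟨n₀, fun n hn => ?_⟩
    rw [hconst n hn, Finset.sum_range_succ]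
    have h1 : ((-1 : ℤ) ^ (d + 1)) * (-1) ^ (d + 1) = 1 := by rw [← mul_pow]; simp
    have h2 : g n = ∑ i ∈ Finset.range (d + 1),
        (-1) ^ i * (if i ≤ d then ε i else (-1) ^ (d + 1) * (h n₀ - g n₀)) *
          ((n + (d + 1 - i) - 1).choose (d + 1 - i) : ℤ) :=
      Finset.sum_congr rfl fun i hi => by
        rw [if_pos (by simpa [Nat.lt_succ_iff] using hi)]
    rw [← h2]
    simp only [if_neg (Nat.not_succ_le_self d), Nat.sub_self, Nat.choose_zero_right, Nat.cast_one]
    linear_combination (-(h n₀ - g n₀)) * h1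
  · intro i hi
    simp only
    rw [if_pos hi.le, hεlt i hi]
  · simp only
    rw [if_pos le_rfl, hεd]

end Sum

/-! ### Recovering `M ∩ yE = yM` from depth -/

section Engine

section

variable {R E M : Type*} [CommRing R] [AddCommGroup E] [Module R E] [AddCommGroup M] [Module R M]

/-- The map `M / (M ∩ y E) → E / y E`. -/
def quotComapMap (f : M →ₗ[R] E) (y : R) :
    (M ⧸ (y • (⊤ : Submodule R E)).comap f) →ₗ[R] QuotSMulTop y E :=
  Submodule.mapQ _ _ f le_rfl

theorem quotComapMap_injective (f : M →ₗ[R] E) (y : R) :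
    Function.Injective (quotComapMap f y) := by
  rw [← LinearMap.ker_eq_bot, LinearMap.ker_eq_bot']
  intro v hv
  obtain ⟨v, rfl⟩ := Submodule.mkQ_surjective _ v
  rw [quotComapMap, Submodule.mkQ_apply, Submodule.mapQ_apply, Submodule.Quotient.mk_eq_zero] at hv
  rwa [Submodule.mkQ_apply, Submodule.Quotient.mk_eq_zero]

theorem smul_top_le_comap (f : M →ₗ[R] E) (y : R) :
    y • ⊤ ≤ (y • (⊤ : Submodule R E)).comap f := by
  intro v hv
  obtain ⟨w, -, rfl⟩ := (Submodule.mem_smul_pointwise_iff_exists _ _ _).1 hv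
  rw [Submodule.mem_comap, map_smul]
  exact Submodule.smul_mem_pointwise_smul _ _ _ trivial

end

variable {R : Type*} [CommRing R] [IsLocalRing R]

section

variable {P Q : Type*} [AddCommGroup P] [Module R P] [AddCommGroup Q] [Module R Q]

/-- The elementary form of: `Hom(k, Q) = 0` and `Ext¹(k, P) = 0` imply `Hom(k, Q/P) = 0`. The
sequence `y, z` on `P` yields a candidate `p` with `yp = yq`; as `y` need not be regular on `Q`, the
element `w` is what identifies `p` with `q`. -/
theorem mem_range_of_forall_maximalIdeal_smul_mem_range (g : P →ₗ[R] Q)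
    (hg : Function.Injective g) {n : ℕ} (hP : DepthGE R (n + 2) P) {w : R} (hw : w ∈ maximalIdeal R)
    (hwQ : IsSMulRegular Q w) {q : Q} (hq : ∀ b ∈ maximalIdeal R, b • q ∈ g.range) :
    q ∈ g.range := by
  obtain ⟨y, hy, hyreg, hP'⟩ := hP.exists_quotSMulTop
  obtain ⟨z, hz, hzreg, -⟩ := hP'.exists_quotSMulTop
  obtain ⟨a, ha⟩ := hq y hy
  obtain ⟨b, hb⟩ := hq z hz
  have h1 : z • a = y • b := hg (by rw [map_smul, map_smul, ha, hb, smul_comm])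
  have h2 : a ∈ y • (⊤ : Submodule R P) := by
    apply mem_of_isSMulRegular_quotient_of_smul_mem hzreg
    rw [h1]
    exact Submodule.smul_mem_pointwise_smul _ _ _ trivial
  obtain ⟨p, -, rfl⟩ := (Submodule.mem_smul_pointwise_iff_exists _ _ _).1 h2
  obtain ⟨u, hu⟩ := hq w hw
  have h3 : u = w • p := hyreg (by
    change y • u = y • w • p
    apply hg
    rw [map_smul, hu, smul_comm y w p, map_smul, ha, smul_comm])
  exact ⟨p, hwQ (by change w • g p = w • q; rw [← map_smul, ← h3, hu])⟩

theorem mem_range_of_forall_pow_maximalIdeal_smul_mem_range (g : P →ₗ[R] Q)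
    (hg : Function.Injective g) {n : ℕ} (hP : DepthGE R (n + 2) P) {w : R} (hw : w ∈ maximalIdeal R)
    (hwQ : IsSMulRegular Q w) (j : ℕ) {q : Q} (hq : ∀ b ∈ maximalIdeal R ^ j, b • q ∈ g.range) :
    q ∈ g.range := by
  induction j generalizing q with
  | zero => simpa using hq 1 (by simp)
  | succ j ih =>
    refine mem_range_of_forall_maximalIdeal_smul_mem_range g hg hP hw hwQ fun s hs => ih ?_
    intro b hb
    rw [← mul_smul]
    exact hq _ (by rw [pow_succ]; exact Ideal.mul_mem_mul hb hs)

end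

variable {E M : Type*} [AddCommGroup E] [Module R E] [AddCommGroup M] [Module R M]

/-- If `y` is filter-regular on the cokernel of `M → E` and `M / (M ∩ y E)` has depth at least
two, then `M ∩ y E = y M`. -/
theorem comap_smul_top_le_of_depthGE [IsNoetherianRing R] [Module.Finite R E]
    (f : M →ₗ[R] E) (hf : Function.Injective f) {y : R} (hy : y ∈ maximalIdeal R)
    {w : R} (hw : w ∈ maximalIdeal R) (hwreg : IsSMulRegular (QuotSMulTop y E) w)
    {n : ℕ}
    (hdepth : DepthGE R (n + 2) (M ⧸ (y • (⊤ : Submodule R E)).comap f)) {c : ℕ}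
    (hc : ∀ v : E ⧸ f.range, y • v = 0 → ∀ b ∈ maximalIdeal R ^ c, b • v = 0) :
    (y • (⊤ : Submodule R E)).comap f ≤ y • ⊤ := by
  have : IsNoetherian R (E ⧸ f.range) := isNoetherian_of_isNoetherianRing_of_finite R _
  let W : ℕ →o Submodule R (E ⧸ f.range) :=
    ⟨fun j => ⨅ b : (maximalIdeal R ^ j : Ideal R), LinearMap.ker (LinearMap.lsmul R _ (b : R)), by
      intro i j hij v hv
      simp only [Submodule.mem_iInf, LinearMap.mem_ker, LinearMap.lsmul_apply, Subtype.forall]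
        at hv ⊢
      exact fun b hb => hv b (Ideal.pow_le_pow_right hij hb)⟩
  have hW : ∀ j v, v ∈ W j ↔ ∀ b ∈ maximalIdeal R ^ j, b • v = 0 := by
    intro j v
    change v ∈ (⨅ b : (maximalIdeal R ^ j : Ideal R), LinearMap.ker (LinearMap.lsmul R _ (b : R))) ↔ _
    simp
  obtain ⟨j, hj⟩ := monotone_stabilizes_iff_noetherian.2 this W
  have hWj : ∀ i, W i ≤ W j := by
    intro i
    rcases le_total i j with h | h
    · exact W.monotone h
    · exact (hj i h).ge
  -- Here `W` is the torsion `H⁰_𝔪(C)`, `C = E / M`. The cokernel of `M / (M ∩ yE) → E / yE` is `C /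
  -- yC`, which has no such torsion, so `W ⊆ yC`. Filter-regularity puts the cofactor in `W` again,
  -- whence `W = yW` and `W = 0` by Nakayama.
  have hle : W j ≤ Ideal.span {y} • W j := by
    intro v hv
    obtain ⟨e, rfl⟩ := Submodule.mkQ_surjective _ v
    have h1 : (Submodule.mkQ (y • (⊤ : Submodule R E)) e) ∈ (quotComapMap f y).range := by
      refine mem_range_of_forall_pow_maximalIdeal_smul_mem_range _ (quotComapMap_injective f y)
        hdepth hw hwreg j fun b hb => ?_
      have h2 := (hW j _).1 hv b hb
      rw [← map_smul, Submodule.mkQ_apply, Submodule.Quotient.mk_eq_zero] at h2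
      obtain ⟨m, hm⟩ := h2
      exact ⟨Submodule.Quotient.mk m, by
        rw [← map_smul, ← hm]
        rfl⟩
    obtain ⟨m, hm⟩ := h1
    obtain ⟨m, rfl⟩ := Submodule.mkQ_surjective _ m
    rw [quotComapMap, Submodule.mkQ_apply, Submodule.mapQ_apply, Submodule.mkQ_apply, eq_comm,
      Submodule.Quotient.eq] at hm
    obtain ⟨e', -, he'⟩ := (Submodule.mem_smul_pointwise_iff_exists _ _ _).1 hm
    have h3 : f.range.mkQ e = y • f.range.mkQ e' := by
      rw [← map_smul, he', map_sub, sub_eq_self.2]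
      rw [Submodule.mkQ_apply, Submodule.Quotient.mk_eq_zero]
      exact ⟨m, rfl⟩
    rw [h3]
    refine Submodule.smul_mem_smul (Ideal.mem_span_singleton_self y) (hWj (c + j) ?_)
    rw [hW]
    intro b hb
    rw [pow_add] at hb
    refine Submodule.mul_induction_on hb ?_ ?_
    · intro b₁ hb₁ b₂ hb₂
      rw [mul_smul]
      refine hc _ ?_ b₁ hb₁
      rw [smul_comm, ← h3]
      exact (hW j _).1 hv b₂ hb₂
    · intro b₁ b₂ h₁ h₂
      rw [add_smul, h₁, h₂, add_zero]
  have hbot := Submodule.eq_bot_of_le_smul_of_le_jacobson_bot (Ideal.span {y}) (W j)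
    (IsNoetherian.noetherian _) hle (by
      rw [IsLocalRing.jacobson_eq_maximalIdeal _ bot_ne_top]
      simpa [Ideal.span_le] using hy)
  intro v hv
  obtain ⟨e, -, he⟩ := (Submodule.mem_smul_pointwise_iff_exists _ _ _).1 hv
  have h1 : f.range.mkQ e ∈ W j := by
    refine hWj c ((hW c _).2 (hc _ ?_))
    rw [← map_smul, he, Submodule.mkQ_apply, Submodule.Quotient.mk_eq_zero]
    exact ⟨v, rfl⟩
  rw [hbot, Submodule.mem_bot, Submodule.mkQ_apply, Submodule.Quotient.mk_eq_zero] at h1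
  obtain ⟨m, rfl⟩ := h1
  have : v = y • m := hf (by rw [map_smul, he])
  rw [this]
  exact Submodule.smul_mem_pointwise_smul _ _ _ trivial

/-- Existence of generic generators which are superficial for `M` and filter-regular on `C`. -/
theorem exists_superficial [IsNoetherianRing R] [Infinite (ResidueField R)] (M C : Type*)
    [AddCommGroup M] [Module R M] [Module.Finite R M] [AddCommGroup C] [Module R C]
    [Module.Finite R C] {d : ℕ} (x : Fin (d + 1) → R) :
    ∃ y : R, Ideal.span {y} ⊔ Ideal.span (Set.range (Fin.tail x)) = Ideal.span (Set.range x) ∧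
      (∃ c : ℕ, ∀ n ≥ c, ∀ z ∈ Ideal.span (Set.range x) ^ n • (⊤ : Submodule R M),
        y • z ∈ Ideal.span (Set.range x) ^ (n + 2) • (⊤ : Submodule R M) →
        z ∈ Ideal.span (Set.range x) ^ (n + 1) • (⊤ : Submodule R M)) ∧
      ∃ c : ℕ, ∀ v : C, y • v = 0 → ∀ b ∈ Ideal.span (Set.range x) ^ c, b • v = 0 := by
  obtain ⟨𝒮₁, hfin₁, htop₁, h₁⟩ := exists_finite_submodules_superficial (M := M) x
  obtain ⟨𝒮₂, hfin₂, htop₂, h₂⟩ := exists_finite_submodules_pow_smul_eq_zero R (N := C) x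
  -- Avoiding `S₀` makes the coefficient of `x 0` a unit, so `y` can replace `x 0` as a generator.
  let S₀ : Submodule R (Fin (d + 1) → R) := Submodule.comap
    (LinearMap.proj (R := R) (φ := fun _ => R) (0 : Fin (d + 1))) (maximalIdeal R)
  have hS₀ : ⊤ ≠ S₀ := by
    intro h
    have : (fun _ => 1 : Fin (d + 1) → R) ∈ S₀ := h ▸ trivial
    have h1 : (1 : R) ∈ maximalIdeal R := this
    exact (Ideal.ne_top_iff_one _).1 (maximalIdeal.isMaximal R).ne_top h1
  obtain ⟨a, ha⟩ := exists_notMem_of_finite_of_infinite_residueField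
    ((hfin₁.union hfin₂).insert S₀) (by simp [htop₁, htop₂, hS₀])
  refine ⟨∑ i, a i * x i, ?_, h₁ a fun P hP => ha P (by simp [hP]),
    h₂ a fun P hP => ha P (by simp [hP])⟩
  have hunit : IsUnit (a 0) := by
    have h1 : a ∉ S₀ := ha S₀ (by simp)
    have h2 : a 0 ∉ maximalIdeal R := h1
    simpa using h2
  apply le_antisymm
  · refine sup_le ?_ (Ideal.span_mono ?_)
    · rw [Ideal.span_singleton_le_iff_mem]
      exact Ideal.sum_mem _ fun i _ =>
        Ideal.mul_mem_left _ _ (Ideal.subset_span (Set.mem_range_self i))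
    · rintro _ ⟨i, rfl⟩
      exact ⟨i.succ, rfl⟩
  · rw [Ideal.span_le]
    have htail : ∀ i : Fin d, x i.succ ∈ Ideal.span (Set.range (Fin.tail x)) := fun i =>
      Ideal.subset_span ⟨i, rfl⟩
    rintro _ ⟨i, rfl⟩
    refine Fin.cases ?_ (fun i => ?_) i
    · obtain ⟨u, hu⟩ := hunit
      have h1 : x 0 = (↑u⁻¹ : R) * (∑ i, a i * x i) -
          (↑u⁻¹ : R) * ∑ i : Fin d, a i.succ * x i.succ := by
        rw [Fin.sum_univ_succ, ← mul_sub, add_sub_cancel_right, ← hu, ← mul_assoc, Units.inv_mul,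
          one_mul]
      rw [h1]
      refine Ideal.sub_mem _ (Ideal.mul_mem_left _ _ (Ideal.mem_sup_left
        (Ideal.mem_span_singleton_self _))) (Ideal.mul_mem_left _ _ (Ideal.mem_sup_right
        (Ideal.sum_mem _ fun i _ => Ideal.mul_mem_left _ _ (htail i))))
    · exact Ideal.mem_sup_right (htail i)

end Engine

/-! ### The induction on dimension -/

section Main

theorem ofList_ofFn {R : Type*} [CommRing R] {d : ℕ} (x : Fin d → R) :
    Ideal.ofList (List.ofFn x) = Ideal.span (Set.range x) := by
  rw [Ideal.ofList]
  congr 1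
  ext r
  simp [List.mem_ofFn]

variable {R : Type*} [CommRing R] [IsLocalRing R]

/-- The Hilbert function of `M` with respect to `I`. -/
noncomputable def hilbertFunction (M : Type*) [AddCommGroup M] [Module R M] (I : Ideal R) (n : ℕ) :
    ℤ :=
  ((Module.length R (M ⧸ (I ^ n • ⊤ : Submodule R M))).toNat : ℤ)

variable [IsNoetherianRing R] {E M : Type*} [AddCommGroup E] [Module R E] [Module.Finite R E]
  [AddCommGroup M] [Module R M]

theorem isSMulRegular_of_span_sup_eq {d : ℕ} {x : Fin (d + 1) → R}
    (hx : ∀ i, x i ∈ maximalIdeal R) {K : ℕ}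
    (hK : maximalIdeal R ^ K ≤ Ideal.span (Set.range x) ⊔ Module.annihilator R E)
    (hE : DepthGE R (d + 1) E) {y : R}
    (hy : Ideal.span {y} ⊔ Ideal.span (Set.range (Fin.tail x)) = Ideal.span (Set.range x)) :
    IsSMulRegular E y := by
  have h := DepthGE.isWeaklyRegular (M := E) (K := K) (y :: List.ofFn (Fin.tail x)) (by
    have h1 : Ideal.span (Set.range x) ≤ maximalIdeal R := by
      rw [Ideal.span_le]
      rintro _ ⟨i, rfl⟩
      exact hx i
    intro r hr
    rcases List.mem_cons.1 hr with rfl | hr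
    · exact h1 (hy ▸ Ideal.mem_sup_left (Ideal.mem_span_singleton_self _))
    · obtain ⟨i, rfl⟩ := List.mem_ofFn.1 hr
      exact hx _) (by simpa using hE) (by
    rwa [Ideal.ofList_cons, ofList_ofFn, hy])
  exact ((isWeaklyRegular_cons_iff _ _ _).1 h).1

theorem eventuallyHilbert_of_span_singleton [Module.Finite R M] {y : R} (hreg : IsSMulRegular M y)
    {K : ℕ} (hK : maximalIdeal R ^ K ≤ Ideal.span {y} ⊔ Module.annihilator R M) :
    ∃ e : ℕ → ℤ, EventuallyHilbert (hilbertFunction M (Ideal.span {y})) 1 e ∧ e 1 = 0 := by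
  set I := Ideal.span {y}
  have hyI : y ∈ I := Ideal.mem_span_singleton_self y
  have hrange : (LinearMap.lsmul R M y).range = y • (⊤ : Submodule R M) :=
    LinearMap.range_eq_map _
  have hI : (I • ⊤ : Submodule R M) = y • ⊤ := Submodule.ideal_span_singleton_smul y ⊤
  have hstep : ∀ n, hilbertFunction M I (n + 1) = hilbertFunction M I n + hilbertFunction M I 1 := by
    intro n
    have h1 := length_quotient_eq_add_of_comap_eq (LinearMap.lsmul R M y)
      (I ^ n • ⊤) (I ^ (n + 1) • ⊤) (by
        refine le_antisymm (fun z hz => ?_) (fun z hz => smul_mem_pow_succ_smul hyI hz)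
        rw [Submodule.mem_comap, LinearMap.lsmul_apply, pow_succ', mul_smul,
          Submodule.ideal_span_singleton_smul, Submodule.mem_smul_pointwise_iff_exists] at hz
        obtain ⟨w, hw, hwz⟩ := hz
        rwa [← hreg hwz])
    have h2 : (I ^ (n + 1) • ⊤ : Submodule R M) ⊔ (LinearMap.lsmul R M y).range = I ^ 1 • ⊤ := by
      rw [hrange, pow_one, hI, sup_eq_right, ← hI, pow_succ', mul_smul]
      exact Submodule.smul_mono le_rfl le_top
    rw [h2] at h1
    rw [hilbertFunction, h1, ENat.toNat_add (length_quotient_pow_smul_ne_top hK _)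
      (length_quotient_pow_smul_ne_top hK _)]
    push_cast
    rfl
  have h0 : ∀ n, hilbertFunction M I n = n * hilbertFunction M I 1 := by
    intro n
    induction n with
    | zero => simp [hilbertFunction, Submodule.Quotient.subsingleton_iff]
    | succ n ih => rw [hstep, ih]; push_cast; ring
  refine ⟨fun i => if i = 0 then hilbertFunction M I 1 else 0, .of_forall fun n => ?_, rfl⟩
  rw [h0]
  simp
  ring

/-- The Hilbert function of a submodule of a module of depth `d` with respect to an ideal generated
by `d` elements. -/
theorem exists_eventuallyHilbert [Infinite (ResidueField R)] (d : ℕ) (f : M →ₗ[R] E)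
    (hf : Function.Injective f) (x : Fin (d + 1) → R) (hx : ∀ i, x i ∈ maximalIdeal R) {K : ℕ}
    (hK : maximalIdeal R ^ K ≤ Ideal.span (Set.range x) ⊔ Module.annihilator R E)
    (hE : DepthGE R (d + 1) E) :
    ∃ e : ℕ → ℤ, EventuallyHilbert (hilbertFunction M (Ideal.span (Set.range x))) (d + 1) e ∧
      e 1 ≤ 0 ∧ (e 1 = 0 → DepthGE R (d + 1) M) := by
  induction d generalizing E M with
  | zero =>
    have : IsNoetherian R E := isNoetherian_of_isNoetherianRing_of_finite R E
    have : Module.Finite R M := Module.Finite.of_injective f hf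
    have hxspan : Ideal.span (Set.range x) = Ideal.span {x 0} := by
      congr 1
      ext r
      simp [Fin.exists_fin_one, eq_comm]
    have hreg : IsSMulRegular M (x 0) := by
      refine IsSMulRegular.of_injective f hf ?_
      exact isSMulRegular_of_span_sup_eq hx hK hE (by rw [hxspan]; simp [Set.range_eq_empty])
    obtain ⟨e, he, he1⟩ := eventuallyHilbert_of_span_singleton (K := K) hreg
      (hxspan ▸ hK.trans (sup_le_sup_left (LinearMap.annihilator_le_of_injective f hf) _))
    refine ⟨e, by rwa [hxspan], he1.le, fun _ => ?_⟩
    exact DepthGE.of_quotSMulTop (hx 0) hreg ⟨[], rfl, by simp, .nil R _⟩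
  | succ d ih =>
    have : IsNoetherian R E := isNoetherian_of_isNoetherianRing_of_finite R E
    have : Module.Finite R M := Module.Finite.of_injective f hf
    have hannEM := LinearMap.annihilator_le_of_injective f hf
    obtain ⟨y, hyspan, ⟨c₁, hc₁⟩, c₂, hc₂⟩ := exists_superficial M (E ⧸ f.range) x
    set I := Ideal.span (Set.range x) with hI
    have hIm : I ≤ maximalIdeal R := by
      rw [Ideal.span_le]
      rintro _ ⟨i, rfl⟩
      exact hx i
    have hyI : y ∈ I := hyspan ▸ Ideal.mem_sup_left (Ideal.mem_span_singleton_self _)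
    have hyE : IsSMulRegular E y := isSMulRegular_of_span_sup_eq hx hK hE hyspan
    have hyM : IsSMulRegular M y := hyE.of_injective f hf
    let N : Submodule R M := (y • (⊤ : Submodule R E)).comap f
    have hyN : y • ⊤ ≤ N := smul_top_le_comap f y
    have hcN : I ^ c₂ • N ≤ y • (⊤ : Submodule R M) := by
      rw [Submodule.smul_le]
      intro b hb v hv
      obtain ⟨e, -, he⟩ := (Submodule.mem_smul_pointwise_iff_exists _ _ _).1 hv
      have h1 := hc₂ (f.range.mkQ e) (by
        rw [← map_smul, he, Submodule.mkQ_apply, Submodule.Quotient.mk_eq_zero]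
        exact ⟨v, rfl⟩) b hb
      rw [← map_smul, Submodule.mkQ_apply, Submodule.Quotient.mk_eq_zero] at h1
      obtain ⟨m, hm⟩ := h1
      have h2 : b • v = y • m := hf (by rw [map_smul, map_smul, ← he, hm, smul_comm])
      rw [h2]
      exact Submodule.smul_mem_pointwise_smul _ _ _ trivial
    have hlen : Module.length R (N ⧸ (y • (⊤ : Submodule R M)).comap N.subtype) ≠ ⊤ := by
      refine length_ne_top_of_pow_le_annihilator (K := K) (n := c₂) (I := I)
        (hK.trans (sup_le_sup_left (hannEM.trans
          ((LinearMap.annihilator_le_of_injective N.subtype N.injective_subtype).trans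
          (LinearMap.annihilator_le_of_surjective _ (Submodule.mkQ_surjective _)))) _)) ?_
      intro b hb
      rw [Module.mem_annihilator]
      intro v
      obtain ⟨v, rfl⟩ := Submodule.mkQ_surjective _ v
      rw [← map_smul, Submodule.mkQ_apply, Submodule.Quotient.mk_eq_zero]
      exact hcN (Submodule.smul_mem_smul hb v.2)
    have hyann : y ∈ Module.annihilator R (M ⧸ N) :=
      LinearMap.annihilator_le_of_surjective (Submodule.factor hyN)
        (Submodule.factor_surjective _) (QuotSMulTop.mem_annihilator M y)
    have hK' : maximalIdeal R ^ K ≤ Ideal.span (Set.range (Fin.tail x)) ⊔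
        Module.annihilator R (QuotSMulTop y E) := by
      refine hK.trans (sup_le ?_ (le_sup_of_le_right
        (LinearMap.annihilator_le_of_surjective _ (Submodule.mkQ_surjective _))))
      rw [← hyspan]
      refine sup_le (le_sup_of_le_right ?_) le_sup_left
      rw [Ideal.span_singleton_le_iff_mem]
      exact QuotSMulTop.mem_annihilator E y
    have hE' : DepthGE R (d + 1) (QuotSMulTop y E) := hE.quotSMulTop (hIm hyI) hyE
    have hx' : ∀ i, Fin.tail x i ∈ maximalIdeal R := fun i => hx _
    obtain ⟨e', he', hle', hdepth⟩ := ih (quotComapMap f y) (quotComapMap_injective f y)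
      (Fin.tail x) hx' hK' hE'
    -- Since `y` kills `M / N`, the filtration by powers of `I` is that of an ideal with one
    -- generator fewer.
    have hpow : ∀ n, (I ^ n • ⊤ : Submodule R (M ⧸ N)) =
        Ideal.span (Set.range (Fin.tail x)) ^ n • ⊤ := by
      intro n
      rw [← hyspan, sup_span_singleton_pow_smul_top hyann]
    have hKMN : maximalIdeal R ^ K ≤ I ⊔ Module.annihilator R (M ⧸ N) :=
      hK.trans (sup_le_sup_left (hannEM.trans
        (LinearMap.annihilator_le_of_surjective _ (Submodule.mkQ_surjective _))) _)
    obtain ⟨e, he, hei, hed⟩ := EventuallyHilbert.of_difference (h := hilbertFunction M I)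
      (l := (Module.length R (N ⧸ (y • (⊤ : Submodule R M)).comap N.subtype)).toNat) he' (by
        filter_upwards [eventually_length_quotient_pow_succ I hyN hcN hyI
          (eventually_mem_pow_smul_of_smul_mem I hyM hc₁)] with n hn
        rw [hilbertFunction, hn, ENat.toNat_add (length_quotient_pow_smul_ne_top
          (hK.trans (sup_le_sup_left hannEM _)) _) (by
            simpa using ⟨hlen, length_quotient_pow_smul_ne_top hKMN _⟩),
          ENat.toNat_add hlen (length_quotient_pow_smul_ne_top hKMN _)]
        push_cast
        rw [hilbertFunction, hilbertFunction, hpow])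
    have hfinal : N ≤ y • ⊤ → DepthGE R (d + 1) (M ⧸ N) → DepthGE R (d + 1 + 1) M := by
      intro hle h
      refine DepthGE.of_quotSMulTop (hIm hyI) hyM (h.of_linearEquiv ?_)
      exact Submodule.quotEquivOfEq _ _ (le_antisymm hle hyN)
    refine ⟨e, he, ?_⟩
    -- Only with two generators does `l` enter `e 1`: there `e 1 = e' 1 - l`, with `e' 1 ≤ 0 ≤ l`,
    -- so vanishing forces both terms to vanish. With more generators `e 1 = e' 1`, and the depth of
    -- `M / N` has to supply `N = yM`.
    rcases d with _ | d
    · have hl0 : (0 : ℤ) ≤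
          (Module.length R (N ⧸ (y • (⊤ : Submodule R M)).comap N.subtype)).toNat :=
        Int.natCast_nonneg _
      refine ⟨by simp at hed; omega, fun h0 => ?_⟩
      have h1 : e' 1 = 0 := by simp at hed; omega
      refine hfinal ?_ (hdepth h1)
      have h2 : (Module.length R (N ⧸ (y • (⊤ : Submodule R M)).comap N.subtype)).toNat = 0 := by
        simp at hed; omega
      have h3 := (ENat.toNat_eq_zero.1 h2).resolve_right hlen
      rw [Module.length_eq_zero_iff, Submodule.Quotient.subsingleton_iff] at h3
      intro v hv
      have : (⟨v, hv⟩ : N) ∈ (y • (⊤ : Submodule R M)).comap N.subtype := h3 ▸ trivial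
      exact this
    · rw [hei 1 (by omega)]
      refine ⟨hle', fun h0 => hfinal ?_ (hdepth h0)⟩
      obtain ⟨w, hw, hwreg, -⟩ := hE'.exists_quotSMulTop
      refine comap_smul_top_le_of_depthGE f hf (hIm hyI) hw hwreg (hdepth h0)
        (c := K * (c₂ + 1)) fun v hv b hb => ?_
      obtain ⟨r, hr, a, ha, rfl⟩ := Submodule.mem_sup.1 (pow_mul_le_pow_sup hK c₂ hb)
      rw [add_smul, hc₂ v hv r hr, zero_add]
      exact Module.mem_annihilator.1
        (LinearMap.annihilator_le_of_surjective _ (Submodule.mkQ_surjective f.range) ha) v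

end Main

/-! ### Enlarging the residue field by passing to `R(t)` -/

section BaseChange

variable {R : Type*} [CommRing R]

instance isPrime_map_C_maximalIdeal (R : Type*) [CommRing R] [IsLocalRing R] :
    ((maximalIdeal R).map (Polynomial.C : R →+* R[X])).IsPrime :=
  Ideal.isPrime_map_C_of_isPrime

/-- The local ring `R(t)`: the localization of `R[t]` at the extension of the maximal ideal. -/
abbrev RationalExtension (R : Type*) [CommRing R] [IsLocalRing R] : Type _ :=
  Localization.AtPrime ((maximalIdeal R).map (Polynomial.C : R →+* R[X]))

namespace RationalExtension

variable (R) [IsLocalRing R]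

theorem map_maximalIdeal : (maximalIdeal R).map (algebraMap R (RationalExtension R)) =
    maximalIdeal (RationalExtension R) := by
  rw [IsScalarTower.algebraMap_eq R R[X] (RationalExtension R), ← Ideal.map_map,
    Polynomial.algebraMap_eq, Localization.AtPrime.map_eq_maximalIdeal]

instance isLocalHom_algebraMap : IsLocalHom (algebraMap R (RationalExtension R)) :=
  ((IsLocalRing.local_hom_TFAE (algebraMap R (RationalExtension R))).out 0 2).2
    (map_maximalIdeal R).le

instance flat : Module.Flat R (RationalExtension R) := Module.Flat.trans R R[X] _

instance isNoetherianRing [IsNoetherianRing R] : IsNoetherianRing (RationalExtension R) :=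
  IsLocalization.isNoetherianRing
    ((maximalIdeal R).map (Polynomial.C : R →+* R[X])).primeCompl _ inferInstance

instance infinite_residueField : Infinite (ResidueField (RationalExtension R)) := by
  refine Infinite.of_injective
    (fun n : ℕ => residue (RationalExtension R) (algebraMap R[X] _ (Polynomial.X ^ n))) ?_
  intro i j hij
  by_contra hne
  simp only at hij
  rw [← sub_eq_zero, ← map_sub, ← map_sub, residue_eq_zero_iff,
    IsLocalization.AtPrime.to_map_mem_maximal_iff _
      ((maximalIdeal R).map (Polynomial.C : R →+* R[X])), Ideal.mem_map_C_iff] at hij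
  have h1 := hij i
  rw [Polynomial.coeff_sub, Polynomial.coeff_X_pow, Polynomial.coeff_X_pow, if_pos rfl,
    if_neg hne, sub_zero] at h1
  exact (Ideal.ne_top_iff_one _).1 (maximalIdeal.isMaximal R).ne_top h1

end RationalExtension

theorem isWeaklyRegular_of_isWeaklyRegular_tensorProduct {S M : Type*} [CommRing S] [Algebra R S]
    [Module.FaithfullyFlat R S] [AddCommGroup M] [Module R M] (xs : List R)
    (h : IsWeaklyRegular (S ⊗[R] M) (xs.map (algebraMap R S))) : IsWeaklyRegular M xs := by
  induction xs generalizing M with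
  | nil => exact .nil R _
  | cons x xs ih =>
    rw [List.map_cons, isWeaklyRegular_cons_iff] at h
    rw [isWeaklyRegular_cons_iff]
    refine ⟨fun v w hvw => ?_, ih ?_⟩
    · refine Module.FaithfullyFlat.tensorProduct_mk_injective (B := S) M (h.1 ?_)
      have h1 : ∀ u : M, algebraMap R S x • TensorProduct.mk R S M 1 u =
          TensorProduct.mk R S M 1 (x • u) := by
        intro u
        rw [algebraMap_smul, map_smul]
      simp only [h1]
      exact congrArg _ hvw
    · exact ((QuotSMulTop.algebraMapTensorEquivTensorQuotSMulTop x M S).isWeaklyRegular_congr _).1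
        h.2

theorem DepthGE.tensorProduct [IsLocalRing R] {S M : Type*} [CommRing S] [IsLocalRing S]
    [Algebra R S] [Module.Flat R S] [IsLocalHom (algebraMap R S)] [AddCommGroup M] [Module R M]
    {n : ℕ} (h : DepthGE R n M) : DepthGE S n (S ⊗[R] M) := by
  obtain ⟨rs, hl, hm, hrs⟩ := h
  refine ⟨rs.map (algebraMap R S), by simpa using hl, ?_,
    hrs.of_flat_of_isBaseChange (TensorProduct.isBaseChange R M S)⟩
  simp only [List.mem_map, forall_exists_index, and_imp, forall_apply_eq_imp_iff₂]
  exact fun r hr => ((local_hom_TFAE (algebraMap R S)).out 0 2 rfl rfl).mp inferInstance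
    (Ideal.mem_map_of_mem _ (hm r hr))

/-- Flat base change multiplies length by the length of the closed fibre `S / 𝔪S`, here a field. -/
theorem length_quotient_map [IsLocalRing R] {S : Type*} [CommRing S] [IsLocalRing S]
    [Algebra R S] [Module.Flat R S] [IsLocalHom (algebraMap R S)]
    (hS : (maximalIdeal R).map (algebraMap R S) = maximalIdeal S) (I : Ideal R) :
    Module.length S (S ⧸ I.map (algebraMap R S)) = Module.length R (R ⧸ I) := by
  have h1 : IsSimpleModule S (S ⧸ maximalIdeal S) :=
    isSimpleModule_iff_isCoatom.2 (maximalIdeal.isMaximal S).out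
  rw [(Algebra.TensorProduct.quotIdealMapEquivTensorQuot S I).toLinearEquiv.length_eq,
    IsLocalRing.length_baseChange, hS,
    Module.length_eq_one S (S ⧸ maximalIdeal S), mul_one]

theorem hilbertFunction_self [IsLocalRing R] (I : Ideal R) (n : ℕ) :
    hilbertFunction R I n = (Module.length R (R ⧸ I ^ n)).toNat := by
  rw [hilbertFunction,
    (Submodule.quotEquivOfEq (I ^ n • ⊤ : Submodule R R) (I ^ n) (Ideal.mul_top _)).length_eq]

theorem hilbertFunction_map [IsLocalRing R] {S : Type*} [CommRing S] [IsLocalRing S]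
    [Algebra R S] [Module.Flat R S] [IsLocalHom (algebraMap R S)]
    (hS : (maximalIdeal R).map (algebraMap R S) = maximalIdeal S) (I : Ideal R) :
    hilbertFunction S (I.map (algebraMap R S)) = hilbertFunction R I := by
  funext n
  rw [hilbertFunction_self, hilbertFunction_self, ← Ideal.map_pow, length_quotient_map hS]

end BaseChange

/-! ### Descent to `R` and the Cohen–Macaulay conclusion -/

section Final

variable {R : Type*} [CommRing R] [IsLocalRing R]

theorem DepthGE.of_depth_eq {M : Type*} [AddCommGroup M] [Module R M] {n : ℕ}
    (h : depth R M = n) : DepthGE R n M := by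
  rcases n with _ | n
  · exact ⟨[], rfl, by simp, .nil R _⟩
  have hne : {n : ℕ∞ | ∃ rs : List R, (rs.length : ℕ∞) = n ∧ (∀ r ∈ rs, r ∈ maximalIdeal R) ∧
      RingTheory.Sequence.IsRegular M rs}.Nonempty := by
    by_contra hemp
    rw [Set.not_nonempty_iff_eq_empty] at hemp
    rw [depth, hemp, sSup_empty] at h
    have : (0 : ℕ∞) = ((n + 1 : ℕ) : ℕ∞) := h
    exact absurd (Nat.cast_injective this) (by simp)
  have := hne.to_subtype
  -- A finite supremum of a nonempty set in `ℕ∞` is attained, so the depth is the length of an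
  -- actual regular sequence.
  obtain ⟨rs, hl, hm, hrs⟩ := ENat.sSup_mem_of_nonempty_of_lt_top
    (h.trans_lt (ENat.natCast_lt_top _))
  refine ⟨rs, ?_, hm, hrs.toIsWeaklyRegular⟩
  exact Nat.cast_injective (hl.trans h)

theorem isCohenMacaulayLocalRing_of_isWeaklyRegular [IsNoetherianRing R] {d : ℕ}
    (hdim : ringKrullDim R = d) {xs : List R} (hl : xs.length = d)
    (hxs : ∀ x ∈ xs, x ∈ maximalIdeal R) (h : IsWeaklyRegular R xs) :
    IsCohenMacaulayLocalRing R := by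
  refine ⟨inferInstance, .inr ?_⟩
  rw [Module.supportDim_self_eq_ringKrullDim, hdim]
  have : depth R R = d := by
    refine le_antisymm (sSup_le ?_) (le_sSup ?_)
    · rintro _ ⟨rs, rfl, -, hrs⟩
      have h1 := ringKrullDim_add_length_eq_ringKrullDim_of_isRegular rs hrs
      have h2 : Nontrivial (R ⧸ Ideal.ofList rs) := by
        rw [Ideal.Quotient.nontrivial_iff]
        intro htop
        exact hrs.top_ne_smul (by rw [htop]; simp)
      have h3 : (0 : WithBot ℕ∞) ≤ ringKrullDim (R ⧸ Ideal.ofList rs) :=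
        ringKrullDim_nonneg_of_nontrivial
      have h4 : (rs.length : WithBot ℕ∞) ≤ d := by
        rw [← hdim, ← h1]
        exact le_add_of_nonneg_left h3
      exact_mod_cast h4
    · exact ⟨xs, by rw [hl], hxs,
        RingTheory.Sequence.IsRegular.of_isWeaklyRegular_of_mem_maximalIdeal R hxs h⟩
  rw [this]
  rfl

theorem exists_pow_maximalIdeal_le_of_length_ne_top {I : Ideal R}
    (h : Module.length R (R ⧸ I) ≠ ⊤) : ∃ K, maximalIdeal R ^ K ≤ I := by
  rw [Module.length_ne_top_iff, isFiniteLength_iff_isNoetherian_isArtinian] at h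
  have := h.2
  have : IsArtinianRing (R ⧸ I) := isArtinian_of_tower R this
  exact exists_maximalIdeal_pow_le_of_isArtinianRing_quotient I

/-- The Hilbert coefficients of an ideal generated by `d` elements in a local ring which embeds
into a module of depth `d`. -/
theorem exists_eventuallyHilbert_of_injective [IsNoetherianRing R] {E : Type*} [AddCommGroup E]
    [Module R E] [Module.Finite R E] (d : ℕ) (f : R →ₗ[R] E) (hf : Function.Injective f)
    (x : Fin (d + 1) → R) (hx : ∀ i, x i ∈ maximalIdeal R) {K : ℕ}
    (hK : maximalIdeal R ^ K ≤ Ideal.span (Set.range x)) (hE : DepthGE R (d + 1) E) :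
    ∃ e : ℕ → ℤ, EventuallyHilbert (hilbertFunction R (Ideal.span (Set.range x))) (d + 1) e ∧
      e 1 ≤ 0 ∧ (e 1 = 0 → IsWeaklyRegular R (List.ofFn x)) := by
  let S := RationalExtension R
  have hS := RationalExtension.map_maximalIdeal R
  have : Module.FaithfullyFlat R S := Module.FaithfullyFlat.of_flat_of_isLocalHom
  let g : S →ₗ[S] S ⊗[R] E :=
    (f.baseChange S).comp (TensorProduct.AlgebraTensorModule.rid R S S).symm.toLinearMap
  have hg : Function.Injective g :=
    (Module.Flat.lTensor_preserves_injective_linearMap (M := S) f hf).comp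
      (TensorProduct.AlgebraTensorModule.rid R S S).symm.injective
  let x' : Fin (d + 1) → S := fun i => algebraMap R S (x i)
  have hx' : ∀ i, x' i ∈ maximalIdeal S := fun i => hS ▸ Ideal.mem_map_of_mem _ (hx i)
  have hspan : Ideal.span (Set.range x') = (Ideal.span (Set.range x)).map (algebraMap R S) := by
    rw [Ideal.map_span, ← Set.range_comp]
    rfl
  have hK' : maximalIdeal S ^ K ≤ Ideal.span (Set.range x') := by
    rw [hspan, ← hS, ← Ideal.map_pow]
    exact Ideal.map_mono hK
  obtain ⟨e, he, he1, hdepth⟩ := exists_eventuallyHilbert d g hg x' hx'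
    (hK'.trans le_sup_left) hE.tensorProduct
  rw [hspan, hilbertFunction_map hS] at he
  refine ⟨e, he, he1, fun h0 => ?_⟩
  have h1 : IsWeaklyRegular S (List.ofFn x') := by
    refine DepthGE.isWeaklyRegular (K := K) _ ?_ (by simpa using hdepth h0)
      ((ofList_ofFn x' ▸ hK').trans le_sup_left)
    intro r hr
    obtain ⟨i, rfl⟩ := List.mem_ofFn.1 hr
    exact hx' i
  refine isWeaklyRegular_of_isWeaklyRegular_tensorProduct (S := S) _ ?_
  rw [(TensorProduct.AlgebraTensorModule.rid R S S).isWeaklyRegular_congr, List.map_ofFn]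
  exact h1

end Final

end LocalHilbert

theorem mainTheorem2 {R : Type*} [CommRing R] [IsLocalRing R] [IsNoetherianRing R]
    (d : ℕ) (hd : 2 ≤ d) (hdim : ringKrullDim R = d)
    {E : Type*} [AddCommGroup E] [Module R E]
    (hE : LocalHilbert.IsMaximalCohenMacaulayModule R E)
    (f : R →ₗ[R] E) (hf : Function.Injective f)
    (hR : ¬ LocalHilbert.IsCohenMacaulayLocalRing R)
    (J : Ideal R) (hJ : LocalHilbert.IsParameterIdeal R R J) :
    LocalHilbert.hilbertCoeff R R J 1 < 0 := by
  obtain ⟨d, rfl⟩ : ∃ k, d = k + 1 := ⟨d - 1, by omega⟩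
  have hmdim : LocalHilbert.moduleDim R R = d + 1 := by
    rw [LocalHilbert.moduleDim, Module.supportDim_self_eq_ringKrullDim, hdim]
    rfl
  obtain ⟨⟨hfin, hcm⟩, hEdim⟩ := hE
  have hdepth : LocalHilbert.DepthGE R (d + 1) E := by
    refine LocalHilbert.DepthGE.of_depth_eq ?_
    have : Nontrivial E := hf.nontrivial
    have h1 := hcm.resolve_left (not_subsingleton E)
    rw [hEdim, hdim] at h1
    exact_mod_cast h1
  obtain ⟨hJm, hgen, hlen⟩ := hJ
  rw [hmdim] at hgen
  obtain ⟨x, rfl⟩ := hgen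
  have hxm : ∀ i, x i ∈ IsLocalRing.maximalIdeal R := fun i =>
    hJm (Ideal.subset_span (Set.mem_range_self i))
  set J := Ideal.span (Set.range x) with hJ
  obtain ⟨K, hK⟩ := LocalHilbert.exists_pow_maximalIdeal_le_of_length_ne_top (I := J) (by
    rwa [← (Submodule.quotEquivOfEq (J • ⊤ : Submodule R R) J (Ideal.mul_top _)).length_eq])
  obtain ⟨e, he, he1, hreg⟩ :=
    LocalHilbert.exists_eventuallyHilbert_of_injective d f hf x hxm hK hdepth
  -- The coefficients are truncated because `e` is unconstrained beyond index `d + 1`.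
  have hcoeff : LocalHilbert.IsHilbertCoefficients R R J
      (fun i => if i ≤ d + 1 then e i else 0) := by
    rw [LocalHilbert.IsHilbertCoefficients, hmdim]
    refine ⟨fun i hi => if_neg (by omega), he.mono fun n hn => ⟨?_, ?_⟩⟩
    · exact LocalHilbert.length_quotient_pow_smul_ne_top (hK.trans le_sup_left) n
    · refine Eq.trans hn (Finset.sum_congr rfl fun i hi => ?_)
      rw [if_pos (by simpa [Nat.lt_succ_iff] using hi)]
  rw [hcoeff.hilbertCoeff_eq, if_pos (by omega)]
  refine lt_of_le_of_ne he1 fun h0 => hR ?_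
  refine LocalHilbert.isCohenMacaulayLocalRing_of_isWeaklyRegular hdim (by simp) ?_ (hreg h0)
  intro r hr
  obtain ⟨i, rfl⟩ := List.mem_ofFn.1 hr
  exact hxm i
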